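/- Let $E$ and $F$ be (real) Banach lattices with $F$ Dedekind complete, and let $n$ be a nonnegative integer. Let $\mathcal P({}^nE;F)$ be the space of continuous $n$-homogeneous polynomials from $E$ to $F$ with the norm $\|P\|=\sup\{\|P(x)\|:\|x\|\le 1\}$. An $n$-homogeneous polynomial $P\colon E\to F$ is positive if its associated symmetric $n$-linear map $T_P$ satisfies $T_P(x_1,\dots,x_n)\ge 0$ for all $x_1,\dots,x_n\ge 0$ in $E$. Let $\mathcal P^r({}^nE;F)$ be the space of differences of positive $n$-homogeneous polynomials, ordered by $P\le Q$ if and only if $Q-P$ is positive, with the norm $\|P\|_r=\inf\{\|Q\|: Q \text{ positive},\ Q\ge |P|\}$. Let $\mathcal A$ be a closed subspace of $\mathcal P({}^nE;F)$, let $\mathcal A^+$ be the set of positive polynomials in $\mathcal A$, and let $\mathcal A^r=\operatorname{span}\mathcal A^+$, with the norm $\|P\|_{\mathcal A,r}=\inf\{\|Q\|:Q\in\mathcal A^+,\ Q\ge|P|\}$. Suppose that $(E,F)$ has the $\mathcal A$-domination property: if $P,Q$ are positive $n$-homogeneous polynomials with $0\le P\le Q$ and $Q\in\mathcal A$, then $P\in\mathcal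 A$. Consider the following conditions. 1. $(\mathcal P^r({}^nE;F),\|\cdot\|_r)$ contains no copy of $c_0$. 2. $(\mathcal A^r,\|\cdot\|_{\mathcal A,r})$ contains no copy of $c_0$. 3. $\mathcal A^r$ is a projection band in $\mathcal P^r({}^nE;F)$. 4. Every positive $n$-homogeneous polynomial $P\colon E\to F$ belongs to $\mathcal A$. Then (1)$\Rightarrow$(2)$\Rightarrow$(3). If, in addition, $F$ is atomic with order continuous norm and every positive $n$-homogeneous polynomial from $E$ to $F$ of finite rank (that is, whose range spans a finite-dimensional subspace of $F$) belongs to $\mathcal A$, then (3)$\Rightarrow$(4). -/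

import Mathlib

open scoped ZeroAtInfty

/-! ### Order-theoretic notions for ordered real vector spaces

For an ordered vector space `V` that is a vector lattice, `u = |x|` means that `u` is the supremum
of `{x, -x}`, and `|x| ∧ |y| = 0` means that `0` is the infimum of `{|x|, |y|}`.  The notions below
are phrased in this way, so that they only use the order and the linear structure. -/

section Riesz

variable {V : Type*} [AddCommGroup V] [Module ℝ V] [PartialOrder V]

/-- `u` is the absolute value `x ⊔ (-x)` of `x`. -/
def IsAbsValue (x u : V) : Prop := IsLUB {x, -x} u

/-- `|x| ≤ |y|`. -/
def AbsLE (x y : V) : Prop := ∃ u v, IsAbsValue x u ∧ IsAbsValue y v ∧ u ≤ v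

/-- `|x| ∧ |y| = 0`. -/
def AbsDisjoint (x y : V) : Prop :=
  ∃ u v, IsAbsValue x u ∧ IsAbsValue y v ∧ IsGLB {u, v} (0 : V)

/-- An (order) ideal: a solid linear subspace. -/
def IsOrderIdeal (B : Submodule ℝ V) : Prop :=
  ∀ x y : V, AbsLE x y → y ∈ B → x ∈ B

/-- A band: an ideal which contains the supremum of each of its subsets that has a supremum in the
whole space. -/
def IsBand (B : Submodule ℝ V) : Prop :=
  IsOrderIdeal B ∧ ∀ (D : Set V) (x : V), D ⊆ B → IsLUB D x → x ∈ B

/-- The disjoint complement of `B`. -/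
def disjointComplement (B : Submodule ℝ V) : Set V :=
  {z | ∀ y ∈ B, AbsDisjoint z y}

/-- A projection band: a band `B` such that `V` is the sum of `B` and its disjoint complement (the
sum is then automatically direct). -/
def IsProjectionBand (B : Submodule ℝ V) : Prop :=
  IsBand B ∧ ∀ x : V, ∃ y ∈ B, ∃ z ∈ disjointComplement B, x = y + z

end Riesz

/-- `W` contains a copy of `c₀` with respect to the norm `N`: there is a linear map from `c₀` (real
null sequences, sup norm) into `W` which is an isomorphism onto its range. -/
def ContainsC0 {W : Type*} [AddCommGroup W] [Module ℝ W] (N : W → ℝ) : Prop :=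
  ∃ (J : C₀(ℕ, ℝ) →ₗ[ℝ] W) (a b : ℝ), 0 < a ∧ 0 < b ∧ ∀ x, a * ‖x‖ ≤ N (J x) ∧ N (J x) ≤ b * ‖x‖

section BanachLattice

/-- Dedekind completeness: every nonempty set that is bounded above has a supremum. -/
def IsDedekindComplete (F : Type*) [PartialOrder F] : Prop :=
  ∀ S : Set F, S.Nonempty → BddAbove S → ∃ u, IsLUB S u

/-- An atom of a vector lattice: an element `a > 0` such that every `0 ≤ y ≤ a` is a multiple of
`a`. -/
def IsRieszAtom {F : Type*} [AddCommGroup F] [Module ℝ F] [PartialOrder F] (a : F) : Prop :=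
  0 < a ∧ ∀ y, 0 ≤ y → y ≤ a → ∃ c : ℝ, y = c • a

/-- An atomic (discrete) vector lattice: every `x > 0` dominates an atom. -/
def IsAtomicRiesz (F : Type*) [AddCommGroup F] [Module ℝ F] [PartialOrder F] : Prop :=
  ∀ x : F, 0 < x → ∃ a, IsRieszAtom a ∧ a ≤ x

/-- Order continuity of the norm: a downward directed family with infimum `0` converges to `0` in
norm. -/
def HasOrderContinuousNorm (F : Type*) [NormedAddCommGroup F] [PartialOrder F] : Prop :=
  ∀ D : Set F, D.Nonempty → DirectedOn (fun x y => y ≤ x) D → IsGLB D 0 →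
    ∀ ε : ℝ, 0 < ε → ∃ x ∈ D, ∀ y ∈ D, y ≤ x → ‖y‖ < ε

end BanachLattice

/-! ### Homogeneous polynomials -/

section Poly

variable {E F : Type*} [AddCommGroup E] [Module ℝ E] [AddCommGroup F] [Module ℝ F]

/-- `T` is a symmetric `n`-linear map with `P x = T (x, …, x)`, that is, `P` is an `n`-homogeneous
polynomial and `T` is its associated symmetric `n`-linear map (unique, by polarization). -/
def IsAssociated {n : ℕ} (T : MultilinearMap ℝ (fun _ : Fin n => E) F) (P : E → F) : Prop :=
  (∀ (σ : Equiv.Perm (Fin n)) (v : Fin n → E), T (fun i => v (σ i)) = T v) ∧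
    ∀ x, P x = T (fun _ => x)

theorem IsAssociated.zero {n : ℕ} :
    IsAssociated (0 : MultilinearMap ℝ (fun _ : Fin n => E) F) 0 :=
  ⟨fun _ _ => rfl, fun _ => rfl⟩

theorem IsAssociated.add {n : ℕ} {S T : MultilinearMap ℝ (fun _ : Fin n => E) F} {P Q : E → F}
    (hS : IsAssociated S P) (hT : IsAssociated T Q) : IsAssociated (S + T) (P + Q) :=
  ⟨fun σ v => by simp [hS.1 σ v, hT.1 σ v], fun x => by simp [hS.2 x, hT.2 x]⟩

theorem IsAssociated.smul {n : ℕ} {T : MultilinearMap ℝ (fun _ : Fin n => E) F} {P : E → F}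
    (c : ℝ) (hT : IsAssociated T P) : IsAssociated (c • T) (c • P) :=
  ⟨fun σ v => by simp [hT.1 σ v], fun x => by simp [hT.2 x]⟩

theorem IsAssociated.map_smul {n : ℕ} {T : MultilinearMap ℝ (fun _ : Fin n => E) F} {P : E → F}
    (hT : IsAssociated T P) (c : ℝ) (x : E) : P (c • x) = c ^ n • P x := by
  rw [hT.2, hT.2]
  have := T.map_smul_univ (fun _ => c) (fun _ => x)
  simpa using this

end Poly

section PosPoly

variable {E F : Type*} [AddCommGroup E] [Module ℝ E] [PartialOrder E]
  [AddCommGroup F] [Module ℝ F] [PartialOrder F]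

/-- `P` is a positive `n`-homogeneous polynomial: its associated symmetric `n`-linear map takes
nonnegative values on tuples of nonnegative vectors. Continuity is not required. -/
def IsPosPoly (n : ℕ) (P : E → F) : Prop :=
  ∃ T : MultilinearMap ℝ (fun _ : Fin n => E) F, IsAssociated T P ∧
    ∀ v : Fin n → E, (∀ i, 0 ≤ v i) → 0 ≤ T v

theorem IsPosPoly.zero (n : ℕ) : IsPosPoly n (0 : E → F) :=
  ⟨0, IsAssociated.zero, fun _ _ => le_rfl⟩

theorem IsPosPoly.add [IsOrderedAddMonoid F] {n : ℕ} {P Q : E → F}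
    (hP : IsPosPoly n P) (hQ : IsPosPoly n Q) : IsPosPoly n (P + Q) := by
  obtain ⟨S, hS, hS0⟩ := hP
  obtain ⟨T, hT, hT0⟩ := hQ
  exact ⟨S + T, hS.add hT, fun v hv => add_nonneg (hS0 v hv) (hT0 v hv)⟩

theorem IsPosPoly.smul [IsOrderedModule ℝ F] {n : ℕ} {P : E → F}
    {c : ℝ} (hc : 0 ≤ c) (hP : IsPosPoly n P) : IsPosPoly n (c • P) := by
  obtain ⟨S, hS, hS0⟩ := hP
  exact ⟨c • S, hS.smul c, fun v hv => smul_nonneg hc (hS0 v hv)⟩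

end PosPoly

/-- A positive multilinear map between vector lattices that vanishes on the diagonal of the
positive cone vanishes. -/
theorem multilinear_eq_zero_of_diag {E F : Type*} [AddCommGroup E] [Module ℝ E] [Lattice E]
    [IsOrderedAddMonoid E] [AddCommGroup F] [Module ℝ F] [PartialOrder F] [IsOrderedAddMonoid F]
    {n : ℕ} (T : MultilinearMap ℝ (fun _ : Fin n => E) F)
    (hpos : ∀ v : Fin n → E, (∀ i, 0 ≤ v i) → 0 ≤ T v)
    (hdiag : ∀ x : E, 0 ≤ x → T (fun _ => x) ≤ 0) : T = 0 := by
  classical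
  have mono : ∀ s : Finset (Fin n), ∀ v w : Fin n → E, (∀ i, 0 ≤ v i) → (∀ i, v i ≤ w i) →
      T v ≤ T (s.piecewise w v) := by
    intro s
    induction s using Finset.induction_on with
    | empty => intro v w _ _; simp
    | insert a s ha ih =>
      intro v w hv hw
      refine (ih v w hv hw).trans ?_
      rw [Finset.piecewise_insert]
      set u := s.piecewise w v with hu
      have hu0 : ∀ i, 0 ≤ u i := by
        intro i
        by_cases hi : i ∈ s
        · simpa [hu, hi] using (hv i).trans (hw i)
        · simpa [hu, hi] using hv i
      have hua : u a = v a := by simp [hu, ha]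
      have h1 : T (Function.update u a (w a)) - T u =
          T (Function.update u a (w a - u a)) := by
        rw [T.map_update_sub]; simp
      have h2 : 0 ≤ T (Function.update u a (w a - u a)) := by
        apply hpos
        intro i
        by_cases hi : i = a
        · subst hi; simpa [hua] using hw i
        · simpa [hi] using hu0 i
      rw [← h1] at h2
      exact sub_nonneg.mp h2
  have hzero : ∀ v : Fin n → E, (∀ i, 0 ≤ v i) → T v = 0 := by
    intro v hv
    refine le_antisymm ?_ (hpos v hv)
    have h := mono Finset.univ v (fun _ => ∑ i, v i) hv
      (fun i => Finset.single_le_sum (fun j _ => hv j) (Finset.mem_univ i))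
    rw [Finset.piecewise_univ] at h
    exact h.trans (hdiag _ (Finset.sum_nonneg fun i _ => hv i))
  have key : ∀ s : Finset (Fin n), ∀ v : Fin n → E, (∀ i, i ∉ s → 0 ≤ v i) → T v = 0 := by
    intro s
    induction s using Finset.induction_on with
    | empty => intro v hv; exact hzero v fun i => hv i (by simp)
    | insert a s ha ih =>
      intro v hv
      have hd : v = Function.update v a ((v a)⁺ - (v a)⁻) := by
        rw [posPart_sub_negPart]; simp
      rw [hd, T.map_update_sub]
      rw [ih, ih, sub_zero]
      · intro i hi
        by_cases hia : i = a
        · subst hia; simp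
        · simpa [hia] using hv i (by simp [hia, hi])
      · intro i hi
        by_cases hia : i = a
        · subst hia; simp
        · simpa [hia] using hv i (by simp [hia, hi])
  ext v
  exact key Finset.univ v (by simp)

/-! ### The space of continuous homogeneous polynomials with the sup norm -/

section ContPoly

/-- The sup norm `sup {‖P x‖ : ‖x‖ ≤ 1}`. -/
noncomputable def polyNorm {E F : Type*} [NormedAddCommGroup E] [NormedAddCommGroup F]
    (P : E → F) : ℝ :=
  sSup {r : ℝ | ∃ x : E, ‖x‖ ≤ 1 ∧ r = ‖P x‖}

theorem polyNorm_le {E F : Type*} [NormedAddCommGroup E] [NormedAddCommGroup F]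
    {P : E → F} {C : ℝ}
    (h : ∀ x : E, ‖x‖ ≤ 1 → ‖P x‖ ≤ C) : polyNorm P ≤ C := by
  refine csSup_le ⟨‖P 0‖, 0, by simp, rfl⟩ ?_
  rintro r ⟨x, hx, rfl⟩
  exact h x hx

variable (n : ℕ) (E F : Type*) [NormedAddCommGroup E] [NormedSpace ℝ E]
  [NormedAddCommGroup F] [NormedSpace ℝ F]

/-- The continuous `n`-homogeneous polynomials, as a subspace of the space of all functions. -/
def contPolySubmodule : Submodule ℝ (E → F) where
  carrier := {P | (∃ T : MultilinearMap ℝ (fun _ : Fin n => E) F, IsAssociated T P) ∧ Continuous P}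
  zero_mem' := ⟨⟨0, IsAssociated.zero⟩, continuous_const⟩
  add_mem' := by
    rintro P Q ⟨⟨S, hS⟩, hP⟩ ⟨⟨T, hT⟩, hQ⟩
    exact ⟨⟨S + T, hS.add hT⟩, hP.add hQ⟩
  smul_mem' := by
    rintro c P ⟨⟨S, hS⟩, hP⟩
    exact ⟨⟨c • S, hS.smul c⟩, hP.const_smul c⟩

/-- The space of continuous `n`-homogeneous polynomials from `E` to `F`. -/
def ContPoly : Type _ := ↥(contPolySubmodule n E F)

instance : AddCommGroup (ContPoly n E F) := inferInstanceAs (AddCommGroup (contPolySubmodule n E F))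

instance : Module ℝ (ContPoly n E F) := inferInstanceAs (Module ℝ (contPolySubmodule n E F))

variable {n E F}

/-- The underlying function of a continuous polynomial. -/
def ContPoly.toFun (P : ContPoly n E F) : E → F := P.1

theorem ContPoly.bddAbove (P : ContPoly n E F) :
    BddAbove {r : ℝ | ∃ x : E, ‖x‖ ≤ 1 ∧ r = ‖P.toFun x‖} := by
  obtain ⟨P, ⟨T, hT⟩, hc⟩ := P
  obtain ⟨δ, hδ, h⟩ := Metric.continuousAt_iff.mp (hc.continuousAt (x := 0)) 1 one_pos
  have hδ2 : 0 < δ / 2 := by positivity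
  refine ⟨((δ / 2) ^ n)⁻¹ * (‖P 0‖ + 1), ?_⟩
  rintro r ⟨x, hx, rfl⟩
  change ‖P x‖ ≤ _
  have h1 : dist ((δ / 2) • x) 0 < δ := by
    rw [dist_zero_right, norm_smul, Real.norm_of_nonneg hδ2.le]
    nlinarith
  have h2 := h h1
  rw [dist_eq_norm] at h2
  have h3 : ‖P ((δ / 2) • x)‖ ≤ ‖P 0‖ + 1 := by
    have := norm_le_norm_add_norm_sub' (P ((δ / 2) • x)) (P 0)
    linarith
  rw [hT.map_smul, norm_smul, norm_pow, Real.norm_of_nonneg hδ2.le] at h3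
  rw [inv_mul_eq_div, le_div_iff₀ (by positivity), mul_comm]
  exact h3

theorem ContPoly.norm_apply_le (P : ContPoly n E F) {x : E} (hx : ‖x‖ ≤ 1) :
    ‖P.toFun x‖ ≤ polyNorm P.toFun :=
  le_csSup P.bddAbove ⟨x, hx, rfl⟩

theorem ContPoly.polyNorm_nonneg (P : ContPoly n E F) : 0 ≤ polyNorm P.toFun :=
  (norm_nonneg _).trans (P.norm_apply_le (x := 0) (by simp))

theorem ContPoly.polyNorm_smul_le (c : ℝ) (P : ContPoly n E F) :
    polyNorm (c • P).toFun ≤ ‖c‖ * polyNorm P.toFun := by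
  refine polyNorm_le fun x hx => ?_
  change ‖c • P.toFun x‖ ≤ _
  rw [norm_smul]
  exact mul_le_mul_of_nonneg_left (P.norm_apply_le hx) (norm_nonneg _)

noncomputable instance : Norm (ContPoly n E F) := ⟨fun P => polyNorm P.toFun⟩

theorem ContPoly.normedCore : NormedSpace.Core ℝ (ContPoly n E F) where
  norm_nonneg P := P.polyNorm_nonneg
  norm_smul c P := by
    refine le_antisymm (P.polyNorm_smul_le c) ?_
    by_cases hc : c = 0
    · subst hc
      rw [norm_zero, zero_mul]
      exact ContPoly.polyNorm_nonneg _
    · have h := ContPoly.polyNorm_smul_le c⁻¹ (c • P)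
      rw [smul_smul, inv_mul_cancel₀ hc, one_smul, norm_inv] at h
      rwa [inv_mul_eq_div, le_div_iff₀ (norm_pos_iff.mpr hc), mul_comm] at h
  norm_triangle P Q := by
    refine polyNorm_le fun x hx => ?_
    change ‖P.toFun x + Q.toFun x‖ ≤ _
    exact (norm_add_le _ _).trans (add_le_add (P.norm_apply_le hx) (Q.norm_apply_le hx))
  norm_eq_zero_iff P := by
    constructor
    · intro h
      have h0 : ∀ x : E, ‖x‖ ≤ 1 → P.toFun x = 0 := fun x hx =>
        norm_le_zero_iff.mp ((P.norm_apply_le hx).trans (le_of_eq h))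
      obtain ⟨P, ⟨T, hT⟩, hc⟩ := P
      apply Subtype.ext
      funext x
      change P x = 0
      have hpos : 0 < ‖x‖ + 1 := by positivity
      have h1 : ‖(‖x‖ + 1)⁻¹ • x‖ ≤ 1 := by
        rw [norm_smul, norm_inv, Real.norm_of_nonneg hpos.le, inv_mul_eq_div, div_le_one hpos]
        linarith
      have h2 : P ((‖x‖ + 1)⁻¹ • x) = 0 := h0 _ h1
      rw [hT.map_smul] at h2
      exact (smul_eq_zero.mp h2).resolve_left (by positivity)
    · rintro rfl
      refine le_antisymm (polyNorm_le fun x _ => ?_) (ContPoly.polyNorm_nonneg _)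
      change ‖(0 : F)‖ ≤ 0
      simp

noncomputable instance : NormedAddCommGroup (ContPoly n E F) :=
  NormedAddCommGroup.ofCore ContPoly.normedCore

noncomputable instance : NormedSpace ℝ (ContPoly n E F) :=
  NormedSpace.ofCore ContPoly.normedCore

/-- The function `P` belongs to the subspace `A` of the space of continuous polynomials. -/
def BelongsTo (A : Submodule ℝ (ContPoly n E F)) (P : E → F) : Prop :=
  ∃ a ∈ A, a.toFun = P

end ContPoly

/-! ### The space of regular homogeneous polynomials -/

section RegPoly

variable (n : ℕ) (E F : Type*) [NormedAddCommGroup E] [NormedSpace ℝ E] [Lattice E]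
  [IsOrderedAddMonoid E] [NormedAddCommGroup F] [NormedSpace ℝ F] [Lattice F]
  [IsOrderedAddMonoid F] [IsOrderedModule ℝ F]

/-- The regular `n`-homogeneous polynomials (differences of two positive ones), as a subspace of
the space of all functions. -/
def regPolySubmodule : Submodule ℝ (E → F) where
  carrier := {P | ∃ Q R : E → F, IsPosPoly n Q ∧ IsPosPoly n R ∧ P = Q - R}
  zero_mem' := ⟨0, 0, IsPosPoly.zero n, IsPosPoly.zero n, by simp⟩
  add_mem' := by
    rintro _ _ ⟨Q, R, hQ, hR, rfl⟩ ⟨Q', R', hQ', hR', rfl⟩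
    exact ⟨Q + Q', R + R', hQ.add hQ', hR.add hR', by abel⟩
  smul_mem' := by
    rintro c _ ⟨Q, R, hQ, hR, rfl⟩
    rcases le_total 0 c with hc | hc
    · exact ⟨c • Q, c • R, hQ.smul hc, hR.smul hc, smul_sub _ _ _⟩
    · refine ⟨(-c) • R, (-c) • Q, hR.smul (by linarith), hQ.smul (by linarith), ?_⟩
      rw [smul_sub, neg_smul, neg_smul]
      abel

/-- The space of regular `n`-homogeneous polynomials from `E` to `F`. -/
def RegPoly : Type _ := ↥(regPolySubmodule n E F)

instance : AddCommGroup (RegPoly n E F) := inferInstanceAs (AddCommGroup (regPolySubmodule n E F))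

instance : Module ℝ (RegPoly n E F) := inferInstanceAs (Module ℝ (regPolySubmodule n E F))

variable {n E F}

/-- The underlying function of a regular polynomial. -/
def RegPoly.toFun (P : RegPoly n E F) : E → F := P.1

/-- The order whose positive cone is the cone of positive polynomials. -/
instance : PartialOrder (RegPoly n E F) where
  le P Q := IsPosPoly n (Q.toFun - P.toFun)
  le_refl P := by rw [sub_self]; exact IsPosPoly.zero n
  le_trans P Q R h h' := by
    have := h'.add h
    rwa [sub_add_sub_cancel] at this
  le_antisymm P Q h h' := by
    obtain ⟨S, hS, hS0⟩ := h
    obtain ⟨T, hT, hT0⟩ := h'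
    have hz : S = 0 := by
      refine multilinear_eq_zero_of_diag S hS0 fun x hx => ?_
      have h1 : S (fun _ => x) = -T (fun _ => x) := by
        rw [← hS.2, ← hT.2]; simp
      rw [h1]
      exact neg_nonpos.mpr (hT0 _ fun _ => hx)
    apply Subtype.ext
    funext x
    have h2 : Q.toFun x - P.toFun x = 0 := by
      have := hS.2 x
      rw [hz] at this
      simpa using this
    exact (sub_eq_zero.mp h2).symm

/-- `Q ≥ |P|`, that is, `Q` is an upper bound of `{P, -P}`. -/
def DominatesAbs (Q P : RegPoly n E F) : Prop := P ≤ Q ∧ -P ≤ Q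

/-- The regular norm `‖P‖_r = inf {‖Q‖ : Q positive, Q ≥ |P|}`. -/
noncomputable def regNorm (P : RegPoly n E F) : ℝ :=
  sInf {r : ℝ | ∃ Q : RegPoly n E F, 0 ≤ Q ∧ DominatesAbs Q P ∧ r = polyNorm Q.toFun}

/-- `A⁺`: the positive polynomials that belong to `A`. -/
def positivePart (A : Submodule ℝ (ContPoly n E F)) : Set (RegPoly n E F) :=
  {P | 0 ≤ P ∧ BelongsTo A P.toFun}

/-- `A^r`: the linear span of `A⁺`. -/
def regSpan (A : Submodule ℝ (ContPoly n E F)) : Submodule ℝ (RegPoly n E F) :=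
  Submodule.span ℝ (positivePart A)

/-- The norm `‖P‖_{A,r} = inf {‖Q‖ : Q ∈ A⁺, Q ≥ |P|}` on `A^r`. -/
noncomputable def regSpanNorm (A : Submodule ℝ (ContPoly n E F)) (P : regSpan A) : ℝ :=
  sInf {r : ℝ | ∃ Q ∈ positivePart A, DominatesAbs Q (P : RegPoly n E F) ∧ r = polyNorm Q.toFun}

/-- The `A`-domination property: if `0 ≤ P ≤ Q` and `Q ∈ A`, then `P ∈ A`. -/
def HasDominationProperty (A : Submodule ℝ (ContPoly n E F)) : Prop :=
  ∀ P Q : RegPoly n E F, 0 ≤ P → P ≤ Q → BelongsTo A Q.toFun → BelongsTo A P.toFun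

end RegPoly

/-! The regular polynomials form a Dedekind complete vector lattice: the Riesz–Kantorovich
construction is applied one variable at a time (`MultilinearMap.isDedekindComplete`), and a supremum
of symmetric maps is symmetric. Domination makes `A^r` an order ideal in this lattice.

(1) ⇒ (2): if some `Q ∈ A⁺` dominates `|P|`, then `|P| ∈ A⁺` by domination. The sup norm is monotone
on positive polynomials, so `‖P‖_r` and `‖P‖_{A,r}` both equal `‖|P|‖` on `A^r`, and a copy of `c₀`
in `A^r` is a copy in the whole space.

(2) ⇒ (3): the minorants of a fixed `P ≥ 0` in `A⁺` are directed upwards. If they are not Cauchy in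
norm, there is an increasing sequence of them whose increments `u k` have norm at least `ε`, while
the sums of the `u k` stay below `P`. Then `|∑ a_k u_k| ≤ sup |a_k| • P` gives an upper
`c₀`-estimate, and Rosenthal's lemma applied to functionals norming the `u k` gives a lower one
along a subsequence (`containsC0_regSpanNorm`). So in the absence of `c₀` the minorants converge;
`A` is closed, and the limit is a greatest minorant of `P` in `A⁺`. An ideal with such greatest
minorants is a projection band (`isProjectionBand_of_exists_isGreatest`).

(3) ⇒ (4): only the band property matters. If `L` is the coordinate functional of an atom `a`, then
`x ↦ L (P x) • a` is a positive minorant of `P` of rank at most one, hence lies in `A`. As `F` is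
atomic, `P` is the supremum of its minorants in `A^r`, hence belongs to the band. -/

set_option linter.unusedSectionVars false

/-! ### Polarization and pointwise limits of polynomials -/

section Polarization

variable {E F : Type*} [AddCommGroup E] [Module ℝ E] [AddCommGroup F] [Module ℝ F] {n : ℕ}

/-- The inclusion–exclusion kernel of polarization: with `t` the image of an index map, it retains
exactly the surjective ones. -/
theorem sum_neg_one_pow_card_subset_compl {α : Type*} [Fintype α] [DecidableEq α]
    (t : Finset α) :
    (∑ u : Finset α, if u ⊆ tᶜ then (-1 : ℝ) ^ u.card else 0) = if t = Finset.univ then 1 else 0 := by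
  rw [← Finset.sum_filter]
  have h1 : (Finset.univ.filter fun u : Finset α => u ⊆ tᶜ) = tᶜ.powerset := by
    ext u; simp
  have h2 := Finset.sum_powerset_neg_one_pow_card (x := tᶜ)
  rw [h1]
  have h3 := congrArg (Int.cast : ℤ → ℝ) h2
  push_cast at h3
  rw [h3]
  simp

/-- The polarization formula. -/
theorem IsAssociated.polarization {T : MultilinearMap ℝ (fun _ : Fin n => E) F} {P : E → F}
    (hT : IsAssociated T P) (v : Fin n → E) :
    (n.factorial : ℝ) • T v = ∑ u : Finset (Fin n), (-1 : ℝ) ^ u.card • P (∑ i ∈ uᶜ, v i) := by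
  classical
  -- Multilinear expansion over the index maps `r` with values outside `u`. The condition is written
  -- as `u ⊆ (image r)ᶜ` so that the sum over `u` can be done first for each fixed `r`.
  have h1 : ∀ u : Finset (Fin n), P (∑ i ∈ uᶜ, v i) =
      ∑ r : Fin n → Fin n, if u ⊆ (Finset.univ.image r)ᶜ then T (fun i => v (r i)) else 0 := by
    intro u
    rw [hT.2, T.map_sum_finset (fun _ j => v j) (fun _ => uᶜ), ← Finset.sum_filter]
    refine Finset.sum_congr ?_ fun _ _ => rfl
    ext r
    simp only [Fintype.mem_piFinset, Finset.mem_compl, Finset.mem_filter, Finset.mem_univ,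
      true_and]
    constructor
    · intro h j hj
      simp only [Finset.mem_compl, Finset.mem_image, Finset.mem_univ, true_and, not_exists]
      rintro i rfl
      exact h i hj
    · intro h i hi
      simpa using h hi
  have h2 : ∀ r : Fin n → Fin n,
      (∑ u : Finset (Fin n), (-1 : ℝ) ^ u.card •
        if u ⊆ (Finset.univ.image r)ᶜ then T (fun i => v (r i)) else 0) =
      if Function.Bijective r then T v else 0 := by
    intro r
    have h3 : (∑ u : Finset (Fin n), (-1 : ℝ) ^ u.card •
        if u ⊆ (Finset.univ.image r)ᶜ then T (fun i => v (r i)) else 0) =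
        (∑ u : Finset (Fin n), if u ⊆ (Finset.univ.image r)ᶜ then (-1 : ℝ) ^ u.card else 0) •
          T (fun i => v (r i)) := by
      rw [Finset.sum_smul]
      refine Finset.sum_congr rfl fun u _ => ?_
      split_ifs <;> simp
    rw [h3, sum_neg_one_pow_card_subset_compl]
    by_cases hr : Function.Bijective r
    · rw [if_pos hr, if_pos (Finset.image_univ_of_surjective hr.2), one_smul]
      exact hT.1 (Equiv.ofBijective r hr) v
    · rw [if_neg hr, if_neg, zero_smul]
      intro h
      exact hr (Finite.injective_iff_bijective.mp (Finite.injective_iff_surjective.mpr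
        fun j => by simpa using Finset.eq_univ_iff_forall.mp h j))
  simp_rw [h1, Finset.smul_sum]
  rw [Finset.sum_comm]
  simp_rw [h2]
  rw [← Finset.sum_filter, Finset.sum_const, ← Nat.cast_smul_eq_nsmul ℝ]
  congr 2
  rw [← Fintype.card_subtype, ← Fintype.card_congr (Equiv.ofBijective
    (fun σ : Equiv.Perm (Fin n) => (⟨σ, σ.bijective⟩ : {r : Fin n → Fin n // Function.Bijective r}))
    ⟨fun σ τ h => Equiv.ext fun i => congrFun (congrArg Subtype.val h) i,
      fun r => ⟨Equiv.ofBijective r.1 r.2, Subtype.ext rfl⟩⟩)]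
  simp [Fintype.card_perm]

theorem IsAssociated.eq_smul_sum {T : MultilinearMap ℝ (fun _ : Fin n => E) F} {P : E → F}
    (hT : IsAssociated T P) (v : Fin n → E) :
    T v = (n.factorial : ℝ)⁻¹ •
      ∑ u : Finset (Fin n), (-1 : ℝ) ^ u.card • P (∑ i ∈ uᶜ, v i) := by
  rw [← hT.polarization, smul_smul, inv_mul_cancel₀ (by positivity), one_smul]

theorem IsAssociated.unique {S T : MultilinearMap ℝ (fun _ : Fin n => E) F} {P : E → F}
    (hS : IsAssociated S P) (hT : IsAssociated T P) : S = T := by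
  ext v
  rw [hS.eq_smul_sum, hT.eq_smul_sum]

theorem IsAssociated.neg {T : MultilinearMap ℝ (fun _ : Fin n => E) F} {P : E → F}
    (hT : IsAssociated T P) : IsAssociated (-T) (-P) := by
  have := hT.smul (-1)
  simpa using this

theorem IsAssociated.sub {S T : MultilinearMap ℝ (fun _ : Fin n => E) F} {P Q : E → F}
    (hS : IsAssociated S P) (hT : IsAssociated T Q) : IsAssociated (S - T) (P - Q) := by
  rw [sub_eq_add_neg, sub_eq_add_neg]
  exact hS.add hT.neg

/-- A pointwise limit of homogeneous polynomials is a homogeneous polynomial. -/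
theorem IsAssociated.of_tendsto [TopologicalSpace F] [T2Space F] [ContinuousAdd F]
    [ContinuousConstSMul ℝ F] {ι : Type*} {l : Filter ι} [l.NeBot]
    {T : ι → MultilinearMap ℝ (fun _ : Fin n => E) F} {P : ι → E → F} {Q : E → F}
    (hT : ∀ i, IsAssociated (T i) (P i))
    (h : ∀ x, Filter.Tendsto (fun i => P i x) l (nhds (Q x))) :
    ∃ S : MultilinearMap ℝ (fun _ : Fin n => E) F, IsAssociated S Q ∧
      ∀ v, Filter.Tendsto (fun i => T i v) l (nhds (S v)) := by
  -- The limit map must be given by polarizing `Q`; all its algebraic properties then follow from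
  -- uniqueness of limits.
  set S : (Fin n → E) → F := fun v => (n.factorial : ℝ)⁻¹ •
      ∑ u : Finset (Fin n), (-1 : ℝ) ^ u.card • Q (∑ i ∈ uᶜ, v i) with hS
  have hlim : ∀ v, Filter.Tendsto (fun i => T i v) l (nhds (S v)) := by
    intro v
    simp_rw [fun i => (hT i).eq_smul_sum v]
    exact (tendsto_finsetSum _ fun u _ => (h _).const_smul _).const_smul _
  refine ⟨⟨S, ?_, ?_⟩, ⟨?_, ?_⟩, hlim⟩
  · intro _ v i x y
    refine tendsto_nhds_unique (hlim _) ?_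
    simp_rw [MultilinearMap.map_update_add]
    exact (hlim _).add (hlim _)
  · intro _ v i c x
    refine tendsto_nhds_unique (hlim _) ?_
    simp_rw [MultilinearMap.map_update_smul]
    exact (hlim _).const_smul _
  · intro σ v
    refine tendsto_nhds_unique (hlim _) ?_
    simp_rw [fun i => (hT i).1 σ v]
    exact hlim _
  · intro x
    refine tendsto_nhds_unique (h x) ?_
    simp_rw [fun i => (hT i).2 x]
    exact hlim _

end Polarization

/-! ### Extension from the positive cone and Riesz decomposition -/

section ConeExtension

variable {E G : Type*} [AddCommGroup E] [Module ℝ E] [Lattice E] [IsOrderedAddMonoid E]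
  [AddCommGroup G] [Module ℝ G]

/-- An additive and positively homogeneous map on the positive cone of a vector lattice extends to
a linear map. -/
theorem exists_linearMap_extending_cone [IsOrderedModule ℝ E] (f : E → G)
    (hadd : ∀ x y, 0 ≤ x → 0 ≤ y → f (x + y) = f x + f y)
    (hsmul : ∀ (c : ℝ) x, 0 < c → 0 ≤ x → f (c • x) = c • f x) :
    ∃ L : E →ₗ[ℝ] G, ∀ x, 0 ≤ x → L x = f x := by
  -- The candidate value does not depend on how `x` is written as a difference of positive elements.
  have key : ∀ a b x : E, 0 ≤ a → 0 ≤ b → x = a - b → f x⁺ - f x⁻ = f a - f b := by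
    intro a b x ha hb hx
    have h1 : x⁺ + b = a + x⁻ := by
      have := posPart_sub_negPart x
      rw [← sub_eq_zero]
      rw [hx] at this ⊢
      rw [← sub_eq_zero] at this
      rw [← this]; abel
    have h2 := congrArg f h1
    rw [hadd _ _ (posPart_nonneg x) hb, hadd _ _ ha (negPart_nonneg x)] at h2
    rw [sub_eq_sub_iff_add_eq_add, h2]
  have f0 : f 0 = 0 := by
    have := hadd 0 0 le_rfl le_rfl
    simpa using this
  have hA : ∀ x y : E, f (x + y)⁺ - f (x + y)⁻ = (f x⁺ - f x⁻) + (f y⁺ - f y⁻) := by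
    intro x y
    rw [key (x⁺ + y⁺) (x⁻ + y⁻) (x + y) (add_nonneg (posPart_nonneg x) (posPart_nonneg y))
      (add_nonneg (negPart_nonneg x) (negPart_nonneg y)),
      hadd _ _ (posPart_nonneg x) (posPart_nonneg y),
      hadd _ _ (negPart_nonneg x) (negPart_nonneg y)]
    · abel
    · conv_lhs => rw [← posPart_sub_negPart x, ← posPart_sub_negPart y]
      abel
  have hpos : ∀ (c : ℝ) (x : E), 0 < c → f (c • x)⁺ - f (c • x)⁻ = c • (f x⁺ - f x⁻) := by
    intro c x hc
    rw [key (c • x⁺) (c • x⁻) (c • x) (smul_nonneg hc.le (posPart_nonneg x))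
      (smul_nonneg hc.le (negPart_nonneg x)), hsmul c _ hc (posPart_nonneg x),
      hsmul c _ hc (negPart_nonneg x), smul_sub]
    rw [← smul_sub, posPart_sub_negPart]
  have hneg : ∀ x : E, f (-x)⁺ - f (-x)⁻ = -(f x⁺ - f x⁻) := by
    intro x
    rw [posPart_neg, negPart_neg, neg_sub]
  refine ⟨⟨⟨fun x => f x⁺ - f x⁻, hA⟩, fun c x => ?_⟩, fun x hx => ?_⟩
  · change f (c • x)⁺ - f (c • x)⁻ = c • (f x⁺ - f x⁻)
    rcases lt_trichotomy c 0 with hc | rfl | hc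
    · have h1 : c • x = -((-c) • x) := by rw [neg_smul, neg_neg]
      rw [h1, hneg, hpos (-c) x (by linarith), neg_smul, neg_neg]
    · simp
    · exact hpos c x hc
  · change f x⁺ - f x⁻ = f x
    rw [posPart_of_nonneg hx, negPart_of_nonneg hx, f0, sub_zero]

theorem riesz_decomposition {E : Type*} [AddCommGroup E] [Lattice E] [IsOrderedAddMonoid E]
    {z₁ z₂ x y : E} (hz₁ : 0 ≤ z₁) (hz₂ : 0 ≤ z₂) (hx : 0 ≤ x) (hy : 0 ≤ y)
    (h : z₁ + z₂ = x + y) :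
    ∃ x₁ x₂ y₁ y₂ : E, 0 ≤ x₁ ∧ 0 ≤ x₂ ∧ 0 ≤ y₁ ∧ 0 ≤ y₂ ∧ x = x₁ + x₂ ∧ y = y₁ + y₂ ∧
      z₁ = x₁ + y₁ ∧ z₂ = x₂ + y₂ := by
  refine ⟨z₁ ⊓ x, x - z₁ ⊓ x, z₁ - z₁ ⊓ x, y - (z₁ - z₁ ⊓ x), le_inf hz₁ hx,
    sub_nonneg.mpr inf_le_right, sub_nonneg.mpr inf_le_left, ?_, by abel, by abel, by abel, ?_⟩
  · have h1 : y - (z₁ - z₁ ⊓ x) = (y - z₁) + z₁ ⊓ x := by abel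
    rw [h1, add_inf]
    refine le_inf (by simpa using hy) ?_
    have : y - z₁ + x = z₂ := by rw [sub_add_eq_add_sub, add_comm y x, ← h]; abel
    rw [this]; exact hz₂
  · have : z₂ = x + y - z₁ := by rw [← h]; abel
    rw [this]; abel

end ConeExtension

/-! ### The Riesz–Kantorovich theorem -/

section RieszKantorovich

variable {E G : Type*} [AddCommGroup E] [Module ℝ E] [Lattice E] [IsOrderedAddMonoid E]
  [IsOrderedModule ℝ E] [AddCommGroup G] [Module ℝ G] [PartialOrder G] [IsOrderedAddMonoid G]
  [IsOrderedModule ℝ G]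

/-- `RieszSum D x s` says that `s = ∑ T_i x_i` for some `T_i ∈ D` and `x_i ≥ 0` with sum `x`. -/
inductive RieszSum (D : Set (E →ₗ[ℝ] G)) : E → G → Prop
  | single {T : E →ₗ[ℝ] G} {x : E} (hT : T ∈ D) (hx : 0 ≤ x) : RieszSum D x (T x)
  | add {x y : E} {a b : G} (hx : RieszSum D x a) (hy : RieszSum D y b) :
      RieszSum D (x + y) (a + b)

theorem RieszSum.nonneg {D : Set (E →ₗ[ℝ] G)} {x : E} {a : G} (h : RieszSum D x a) : 0 ≤ x := by
  induction h with
  | single _ hx => exact hx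
  | add _ _ h₁ h₂ => exact add_nonneg h₁ h₂

theorem RieszSum.le {D : Set (E →ₗ[ℝ] G)} {U : E →ₗ[ℝ] G}
    (hU : ∀ T ∈ D, ∀ x, 0 ≤ x → T x ≤ U x) {x : E} {a : G} (h : RieszSum D x a) : a ≤ U x := by
  induction h with
  | single hT hx => exact hU _ hT _ hx
  | add _ _ h₁ h₂ => rw [map_add]; exact add_le_add h₁ h₂

theorem RieszSum.smul {D : Set (E →ₗ[ℝ] G)} {c : ℝ} (hc : 0 ≤ c) {x : E} {a : G}
    (h : RieszSum D x a) : RieszSum D (c • x) (c • a) := by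
  induction h with
  | single hT hx => rw [← map_smul]; exact .single hT (smul_nonneg hc hx)
  | add _ _ h₁ h₂ => rw [smul_add, smul_add]; exact .add h₁ h₂

/-- This is what makes the supremum of Riesz sums subadditive; Riesz decomposition refines a
partition of `x + y` into partitions of `x` and of `y`. -/
theorem RieszSum.split {D : Set (E →ₗ[ℝ] G)} {z : E} {s : G} (h : RieszSum D z s) :
    ∀ x y : E, 0 ≤ x → 0 ≤ y → z = x + y →
      ∃ a b, RieszSum D x a ∧ RieszSum D y b ∧ s = a + b := by
  induction h with
  | single hT hz =>
    rintro x y hx hy rfl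
    exact ⟨_, _, .single hT hx, .single hT hy, map_add _ _ _⟩
  | add hz₁ hz₂ ih₁ ih₂ =>
    intro x y hx hy h
    obtain ⟨x₁, x₂, y₁, y₂, hx₁, hx₂, hy₁, hy₂, rfl, rfl, h₁, h₂⟩ :=
      riesz_decomposition hz₁.nonneg hz₂.nonneg hx hy h
    obtain ⟨a₁, b₁, ha₁, hb₁, rfl⟩ := ih₁ x₁ y₁ hx₁ hy₁ h₁
    obtain ⟨a₂, b₂, ha₂, hb₂, rfl⟩ := ih₂ x₂ y₂ hx₂ hy₂ h₂
    exact ⟨_, _, ha₁.add ha₂, hb₁.add hb₂, by abel⟩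

/-- The Riesz–Kantorovich theorem: a nonempty set of linear maps into a Dedekind complete ordered
vector space that is bounded above has a supremum. -/
theorem exists_linearMap_sup (hG : IsDedekindComplete G) {D : Set (E →ₗ[ℝ] G)}
    (hD : D.Nonempty) {Q : E →ₗ[ℝ] G} (hQ : ∀ T ∈ D, ∀ x, 0 ≤ x → T x ≤ Q x) :
    ∃ S : E →ₗ[ℝ] G, (∀ T ∈ D, ∀ x, 0 ≤ x → T x ≤ S x) ∧
      ∀ U : E →ₗ[ℝ] G, (∀ T ∈ D, ∀ x, 0 ≤ x → T x ≤ U x) → ∀ x, 0 ≤ x → S x ≤ U x := by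
  obtain ⟨T₀, hT₀⟩ := hD
  -- Off the positive cone the value is arbitrary; only the restriction to the cone gets extended.
  have hex : ∀ x : E, ∃ u, 0 ≤ x → IsLUB {s | RieszSum D x s} u := by
    intro x
    by_cases hx : 0 ≤ x
    · obtain ⟨u, hu⟩ := hG {s | RieszSum D x s} ⟨_, .single hT₀ hx⟩ ⟨Q x, fun s hs => hs.le hQ⟩
      exact ⟨u, fun _ => hu⟩
    · exact ⟨0, fun h => absurd h hx⟩
  choose f hf using hex
  obtain ⟨S, hS⟩ := exists_linearMap_extending_cone f (fun x y hx hy => by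
      have hxy := hf (x + y) (add_nonneg hx hy)
      refine le_antisymm (hxy.2 ?_) ?_
      · intro s hs
        obtain ⟨a, b, ha, hb, rfl⟩ := hs.split x y hx hy rfl
        exact add_le_add ((hf x hx).1 ha) ((hf y hy).1 hb)
      · rw [← le_sub_iff_add_le]
        refine (hf x hx).2 fun a ha => ?_
        rw [le_sub_comm]
        refine (hf y hy).2 fun b hb => ?_
        rw [le_sub_iff_add_le']
        exact hxy.1 (ha.add hb)) (fun c x hc hx => by
      have hcx := hf (c • x) (smul_nonneg hc.le hx)
      refine le_antisymm (hcx.2 ?_) ?_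
      · intro s hs
        have h1 := RieszSum.smul (inv_nonneg.mpr hc.le) hs
        rw [inv_smul_smul₀ hc.ne'] at h1
        have h2 := smul_le_smul_of_nonneg_left ((hf x hx).1 h1) hc.le
        rwa [smul_inv_smul₀ hc.ne'] at h2
      · have h3 : f x ≤ c⁻¹ • f (c • x) := by
          refine (hf x hx).2 fun a ha => ?_
          have h2 := smul_le_smul_of_nonneg_left (hcx.1 (RieszSum.smul hc.le ha))
            (inv_nonneg.mpr hc.le)
          rwa [inv_smul_smul₀ hc.ne'] at h2
        have h4 := smul_le_smul_of_nonneg_left h3 hc.le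
        rwa [smul_inv_smul₀ hc.ne'] at h4)
  refine ⟨S, fun T hT x hx => ?_, fun U hU x hx => ?_⟩
  · rw [hS x hx]
    exact (hf x hx).1 (.single hT hx)
  · rw [hS x hx]
    exact (hf x hx).2 fun s hs => hs.le hU

end RieszKantorovich

/-! ### The order on multilinear maps -/

section MultilinearOrder

variable {E F : Type*} [AddCommGroup E] [Module ℝ E] [Lattice E] [IsOrderedAddMonoid E]
  [AddCommGroup F] [Module ℝ F] [PartialOrder F] [IsOrderedAddMonoid F]

theorem MultilinearMap.ext_cone {n : ℕ} {S T : MultilinearMap ℝ (fun _ : Fin n => E) F}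
    (h : ∀ v : Fin n → E, (∀ i, 0 ≤ v i) → S v = T v) : S = T := by
  rw [← sub_eq_zero]
  refine multilinear_eq_zero_of_diag _ (fun v hv => ?_) fun x hx => ?_
  · simp [h v hv]
  · simp [h _ fun _ => hx]

/-- The order on multilinear maps whose positive cone consists of the maps that are positive on
tuples of positive vectors. -/
instance MultilinearMap.conePartialOrder {n : ℕ} :
    PartialOrder (MultilinearMap ℝ (fun _ : Fin n => E) F) where
  le S T := ∀ v : Fin n → E, (∀ i, 0 ≤ v i) → S v ≤ T v
  le_refl _ _ _ := le_rfl
  le_trans _ _ _ h₁ h₂ v hv := (h₁ v hv).trans (h₂ v hv)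
  le_antisymm _ _ h₁ h₂ := MultilinearMap.ext_cone fun v hv => (h₁ v hv).antisymm (h₂ v hv)

instance MultilinearMap.isOrderedAddMonoid_cone {n : ℕ} :
    IsOrderedAddMonoid (MultilinearMap ℝ (fun _ : Fin n => E) F) where
  add_le_add_left _ _ h U v hv := by simpa using h v hv

instance MultilinearMap.isOrderedModule_cone [IsOrderedModule ℝ F] {n : ℕ} :
    IsOrderedModule ℝ (MultilinearMap ℝ (fun _ : Fin n => E) F) :=
  IsOrderedModule.of_smul_nonneg fun _ hc _ hT v hv => smul_nonneg hc (hT v hv)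

/-- Induction on `n` by currying: an `(n+1)`-linear map is a linear map into the `n`-linear ones,
which are Dedekind complete by induction, so Riesz–Kantorovich applies. For `n = 0` the maps are
constants. -/
theorem MultilinearMap.isDedekindComplete [IsOrderedModule ℝ E] [IsOrderedModule ℝ F]
    (hF : IsDedekindComplete F) (n : ℕ) :
    IsDedekindComplete (MultilinearMap ℝ (fun _ : Fin n => E) F) := by
  induction n with
  | zero =>
    rintro D hD ⟨Q, hQ⟩
    obtain ⟨u, hu⟩ := hF ((fun T : MultilinearMap ℝ (fun _ : Fin 0 => E) F => T 0) '' D)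
      (hD.image _) ⟨Q 0, by rintro _ ⟨T, hT, rfl⟩; exact hQ hT 0 fun i => i.elim0⟩
    refine ⟨MultilinearMap.constOfIsEmpty ℝ _ u, fun T hT v hv => ?_, fun U hU v hv => ?_⟩
    · rw [Subsingleton.elim v 0]
      exact hu.1 ⟨T, hT, rfl⟩
    · rw [Subsingleton.elim v 0]
      refine hu.2 ?_
      rintro _ ⟨T, hT, rfl⟩
      exact hU hT 0 fun i => i.elim0
  | succ n ih =>
    rintro D hD ⟨Q, hQ⟩
    have hle : ∀ S T : MultilinearMap ℝ (fun _ : Fin (n + 1) => E) F,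
        S ≤ T ↔ ∀ x, 0 ≤ x → S.curryLeft x ≤ T.curryLeft x := by
      intro S T
      constructor
      · intro h x hx v hv
        exact h _ (Fin.cases hx hv)
      · intro h v hv
        have := h (v 0) (hv 0) (Fin.tail v) fun i => hv _
        simpa using this
    obtain ⟨S, hS, hS'⟩ := exists_linearMap_sup ih (D := MultilinearMap.curryLeft '' D)
      (hD.image _) (Q := Q.curryLeft) (by
        rintro _ ⟨T, hT, rfl⟩
        exact (hle _ _).mp (hQ hT))
    refine ⟨S.uncurryLeft, fun T hT => ?_, fun U hU => ?_⟩
    · rw [hle, LinearMap.curry_uncurryLeft]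
      exact hS _ ⟨T, hT, rfl⟩
    · rw [hle, LinearMap.curry_uncurryLeft]
      refine hS' _ ?_
      rintro _ ⟨T, hT, rfl⟩
      exact (hle _ _).mp (hU hT)

end MultilinearOrder

/-! ### The vector lattice of regular polynomials -/

section RegPolyLattice

variable {n : ℕ} {E F : Type*} [NormedAddCommGroup E] [NormedSpace ℝ E] [Lattice E]
  [IsOrderedAddMonoid E] [NormedAddCommGroup F] [NormedSpace ℝ F] [Lattice F]
  [IsOrderedAddMonoid F] [IsOrderedModule ℝ F]

@[ext]
theorem RegPoly.ext {P Q : RegPoly n E F} (h : P.toFun = Q.toFun) : P = Q := Subtype.ext h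

@[simp] theorem RegPoly.toFun_zero : (0 : RegPoly n E F).toFun = 0 := rfl
@[simp] theorem RegPoly.toFun_add (P Q : RegPoly n E F) :
    (P + Q).toFun = P.toFun + Q.toFun := rfl
@[simp] theorem RegPoly.toFun_neg (P : RegPoly n E F) : (-P).toFun = -P.toFun := rfl

theorem RegPoly.le_def {P Q : RegPoly n E F} : P ≤ Q ↔ IsPosPoly n (Q.toFun - P.toFun) := Iff.rfl

theorem RegPoly.nonneg_iff {P : RegPoly n E F} : 0 ≤ P ↔ IsPosPoly n P.toFun := by
  rw [RegPoly.le_def, RegPoly.toFun_zero, sub_zero]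

/-- A positive polynomial as an element of the space of regular polynomials. -/
def RegPoly.ofPos (P : E → F) (hP : IsPosPoly n P) : RegPoly n E F :=
  ⟨P, P, 0, hP, IsPosPoly.zero n, by simp⟩

@[simp] theorem RegPoly.toFun_ofPos (P : E → F) (hP : IsPosPoly n P) :
    (RegPoly.ofPos P hP).toFun = P := rfl

theorem RegPoly.ofPos_nonneg (P : E → F) (hP : IsPosPoly n P) : 0 ≤ RegPoly.ofPos P hP :=
  RegPoly.nonneg_iff.mpr hP

theorem RegPoly.exists_sub (P : RegPoly n E F) :
    ∃ Q R : RegPoly n E F, 0 ≤ Q ∧ 0 ≤ R ∧ P = Q - R := by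
  obtain ⟨Q, R, hQ, hR, h⟩ := P.2
  exact ⟨.ofPos Q hQ, .ofPos R hR, RegPoly.ofPos_nonneg _ _, RegPoly.ofPos_nonneg _ _,
    RegPoly.ext h⟩

theorem RegPoly.exists_isAssociated (P : RegPoly n E F) :
    ∃ T : MultilinearMap ℝ (fun _ : Fin n => E) F, IsAssociated T P.toFun := by
  obtain ⟨Q, R, ⟨S, hS, -⟩, ⟨T, hT, -⟩, h⟩ := P.2
  exact ⟨S - T, by rw [RegPoly.toFun, h]; exact hS.sub hT⟩

/-- The symmetric multilinear map associated with a regular polynomial. -/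
noncomputable def RegPoly.toMultilinear (P : RegPoly n E F) :
    MultilinearMap ℝ (fun _ : Fin n => E) F :=
  P.exists_isAssociated.choose

theorem RegPoly.isAssociated (P : RegPoly n E F) : IsAssociated P.toMultilinear P.toFun :=
  P.exists_isAssociated.choose_spec

theorem RegPoly.le_iff {P Q : RegPoly n E F} : P ≤ Q ↔ P.toMultilinear ≤ Q.toMultilinear := by
  have h := Q.isAssociated.sub P.isAssociated
  constructor
  · rintro ⟨T, hT, hT0⟩ v hv
    have := hT0 v hv
    rw [hT.unique h] at this
    simpa using this
  · intro hle
    exact ⟨_, h, fun v hv => by simpa using hle v hv⟩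

theorem RegPoly.nonneg_iff' {P : RegPoly n E F} : 0 ≤ P ↔ 0 ≤ P.toMultilinear := by
  rw [RegPoly.le_iff, (0 : RegPoly n E F).isAssociated.unique IsAssociated.zero]

instance : IsOrderedAddMonoid (RegPoly n E F) where
  add_le_add_left P Q h R := by
    rw [RegPoly.le_def] at h ⊢
    simpa using h

instance : IsOrderedModule ℝ (RegPoly n E F) :=
  IsOrderedModule.of_smul_nonneg fun _ hc _ hP =>
    RegPoly.nonneg_iff.mpr ((RegPoly.nonneg_iff.mp hP).smul hc)

/-- The symmetry of a supremum of symmetric multilinear maps. -/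
theorem MultilinearMap.symmetric_of_isLUB {D : Set (MultilinearMap ℝ (fun _ : Fin n => E) F)}
    {S : MultilinearMap ℝ (fun _ : Fin n => E) F} (hS : IsLUB D S)
    (hD : ∀ T ∈ D, ∀ (σ : Equiv.Perm (Fin n)) (v : Fin n → E), T (fun i => v (σ i)) = T v)
    (σ : Equiv.Perm (Fin n)) (v : Fin n → E) : S (fun i => v (σ i)) = S v := by
  -- Permuting the variables of `S` gives another upper bound of `D`; using the inverse permutation
  -- as well turns the inequality into an equality.
  have h1 : ∀ σ : Equiv.Perm (Fin n), S ≤ S.domDomCongr σ := fun σ => hS.2 fun T hT v hv => by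
    rw [MultilinearMap.domDomCongr_apply, ← hD T hT σ v]
    exact hS.1 hT _ fun i => hv _
  have h2 : S = S.domDomCongr σ := by
    refine (h1 σ).antisymm fun v hv => ?_
    have := h1 σ⁻¹ (fun i => v (σ i)) fun i => hv _
    simpa using this
  conv_rhs => rw [h2]
  rfl

theorem RegPoly.isDedekindComplete [IsOrderedModule ℝ E] (hF : IsDedekindComplete F) :
    IsDedekindComplete (RegPoly n E F) := by
  rintro D ⟨P₀, hP₀⟩ ⟨B, hB⟩
  obtain ⟨S, hS⟩ := MultilinearMap.isDedekindComplete (E := E) hF n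
    (RegPoly.toMultilinear '' D) ⟨_, P₀, hP₀, rfl⟩
    ⟨B.toMultilinear, by rintro _ ⟨P, hP, rfl⟩; exact RegPoly.le_iff.mp (hB hP)⟩
  have hsymm := MultilinearMap.symmetric_of_isLUB hS (by
    rintro _ ⟨P, -, rfl⟩
    exact P.isAssociated.1)
  have hassoc : IsAssociated S fun x => S fun _ => x := ⟨hsymm, fun _ => rfl⟩
  -- The supremum is regular because it exceeds the regular `P₀` by a positive polynomial.
  have hpos : IsPosPoly n ((fun x => S fun _ => x) - P₀.toFun) :=
    ⟨_, hassoc.sub P₀.isAssociated, fun v hv => by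
      simpa using hS.1 ⟨P₀, hP₀, rfl⟩ v hv⟩
  set U : RegPoly n E F := RegPoly.ofPos _ hpos + P₀ with hU
  have hUS : U.toMultilinear = S := by
    refine U.isAssociated.unique ?_
    rw [hU, RegPoly.toFun_add, RegPoly.toFun_ofPos, sub_add_cancel]
    exact hassoc
  refine ⟨U, fun P hP => ?_, fun V hV => ?_⟩
  · rw [RegPoly.le_iff, hUS]
    exact hS.1 ⟨P, hP, rfl⟩
  · rw [RegPoly.le_iff, hUS]
    refine hS.2 ?_
    rintro _ ⟨P, hP, rfl⟩
    exact RegPoly.le_iff.mp (hV hP)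

theorem RegPoly.exists_isLUB_pair [IsOrderedModule ℝ E] (hF : IsDedekindComplete F)
    (P Q : RegPoly n E F) : ∃ U, IsLUB {P, Q} U := by
  refine RegPoly.isDedekindComplete hF _ ⟨P, by simp⟩ ?_
  obtain ⟨P₁, P₂, h₁, h₂, rfl⟩ := P.exists_sub
  obtain ⟨Q₁, Q₂, h₃, h₄, rfl⟩ := Q.exists_sub
  refine ⟨P₁ + Q₁, ?_⟩
  rintro R (rfl | rfl)
  · exact (sub_le_self _ h₂).trans (le_add_of_nonneg_right h₃)
  · exact (sub_le_self _ h₄).trans (le_add_of_nonneg_left h₁)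

/-- The vector lattice structure of the space of regular polynomials with values in a Dedekind
complete vector lattice. -/
@[reducible]
noncomputable def RegPoly.lattice [IsOrderedModule ℝ E] (hF : IsDedekindComplete F) :
    Lattice (RegPoly n E F) where
  sup P Q := (RegPoly.exists_isLUB_pair hF P Q).choose
  le_sup_left P Q := (RegPoly.exists_isLUB_pair hF P Q).choose_spec.1 (by simp)
  le_sup_right P Q := (RegPoly.exists_isLUB_pair hF P Q).choose_spec.1 (by simp)
  sup_le P Q R h₁ h₂ := (RegPoly.exists_isLUB_pair hF P Q).choose_spec.2 (by
    rintro _ (rfl | rfl)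
    exacts [h₁, h₂])
  inf P Q := -(RegPoly.exists_isLUB_pair hF (-P) (-Q)).choose
  inf_le_left P Q := neg_le.mp ((RegPoly.exists_isLUB_pair hF (-P) (-Q)).choose_spec.1 (by simp))
  inf_le_right P Q := neg_le.mp ((RegPoly.exists_isLUB_pair hF (-P) (-Q)).choose_spec.1 (by simp))
  le_inf P Q R h₁ h₂ := le_neg.mp ((RegPoly.exists_isLUB_pair hF (-Q) (-R)).choose_spec.2 (by
    rintro _ (rfl | rfl)
    exacts [neg_le_neg h₁, neg_le_neg h₂]))

end RegPolyLattice

/-! ### A criterion for projection bands -/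

section ProjectionBand

variable {V : Type*} [AddCommGroup V] [Module ℝ V] [Lattice V] [IsOrderedAddMonoid V]

theorem isAbsValue_iff {x u : V} : IsAbsValue x u ↔ u = |x| := by
  have h : IsLUB {x, -x} |x| := isLUB_pair
  exact ⟨fun hu => hu.unique h, fun hu => hu ▸ h⟩

theorem absLE_iff {x y : V} : AbsLE x y ↔ |x| ≤ |y| := by
  simp [AbsLE, isAbsValue_iff]

theorem absDisjoint_iff {x y : V} : AbsDisjoint x y ↔ |x| ⊓ |y| = 0 := by
  have h : IsGLB {|x|, |y|} (|x| ⊓ |y|) := isGLB_pair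
  constructor
  · rintro ⟨u, v, hu, hv, h'⟩
    rw [isAbsValue_iff.mp hu, isAbsValue_iff.mp hv] at h'
    exact h.unique h'
  · intro h'
    exact ⟨_, _, isAbsValue_iff.mpr rfl, isAbsValue_iff.mpr rfl, h' ▸ h⟩

/-- An ideal which contains a greatest minorant of each positive element is a projection band. -/
theorem isProjectionBand_of_exists_isGreatest {B : Submodule ℝ V} (hB : IsOrderIdeal B)
    (h : ∀ x : V, 0 ≤ x → ∃ r, IsGreatest {q | q ∈ B ∧ 0 ≤ q ∧ q ≤ x} r) :
    IsProjectionBand B := by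
  have hsolid : ∀ {x y : V}, |x| ≤ |y| → y ∈ B → x ∈ B := fun hxy hy =>
    hB _ _ (absLE_iff.mpr hxy) hy
  refine ⟨⟨hB, fun D x hD hx => ?_⟩, fun x => ?_⟩
  · rcases D.eq_empty_or_nonempty with rfl | ⟨d₀, hd₀⟩
    · have h1 : ∀ y, x ≤ y := fun y => hx.2 (by simp)
      have h2 : x = 0 := by
        refine le_antisymm (h1 0) ?_
        have := h1 (x + x)
        simpa using this
      rw [h2]; exact B.zero_mem
    -- Translating by `d₀` makes the target positive. Each `(d - d₀)⁺` is a minorant in `B`, so `r +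
    -- d₀` bounds `D` and must equal `x`.
    · obtain ⟨r, ⟨hrB, hr0, hrx⟩, hr⟩ := h (x - d₀) (sub_nonneg.mpr (hx.1 hd₀))
      have h1 : x ≤ r + d₀ := by
        refine hx.2 fun d hd => ?_
        have h2 : (d - d₀)⁺ ∈ B := hsolid (by
          rw [abs_of_nonneg (posPart_nonneg _), ← posPart_add_negPart]
          exact le_add_of_nonneg_right (negPart_nonneg _)) (B.sub_mem (hD hd) (hD hd₀))
        have h3 : (d - d₀)⁺ ≤ r := hr ⟨h2, posPart_nonneg _,
          sup_le (sub_le_sub_right (hx.1 hd) _) (sub_nonneg.mpr (hx.1 hd₀))⟩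
        rw [← sub_le_iff_le_add]
        exact (le_posPart _).trans h3
      have h4 : x = r + d₀ := h1.antisymm (le_sub_iff_add_le.mp hrx)
      rw [h4]
      exact B.add_mem hrB (hD hd₀)
  · obtain ⟨r, ⟨hrB, hr0, hrx⟩, hr⟩ := h x⁺ (posPart_nonneg x)
    obtain ⟨s, ⟨hsB, hs0, hsx⟩, hs⟩ := h x⁻ (negPart_nonneg x)
    -- Otherwise `r + w` would be a larger minorant: nothing of `B` is left below `x - r`.
    have key : ∀ {x r : V}, IsGreatest {q | q ∈ B ∧ 0 ≤ q ∧ q ≤ x} r → ∀ w ∈ B, 0 ≤ w →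
        w ≤ x - r → w = 0 := by
      intro x r hr w hwB hw0 hw
      refine le_antisymm ?_ hw0
      have := hr.2 ⟨B.add_mem hr.1.1 hwB, add_nonneg hr.1.2.1 hw0, le_sub_iff_add_le'.mp hw⟩
      simpa using this
    refine ⟨r - s, B.sub_mem hrB hsB, (x⁺ - r) - (x⁻ - s), fun y hy => ?_, ?_⟩
    · rw [absDisjoint_iff]
      set w := |x⁺ - r - (x⁻ - s)| ⊓ |y| with hw
      have hw0 : 0 ≤ w := le_inf (abs_nonneg _) (abs_nonneg _)
      have hwB : w ∈ B := hsolid (by rw [abs_of_nonneg hw0]; exact inf_le_right) hy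
      have ha : 0 ≤ x⁺ - r := sub_nonneg.mpr hrx
      have hb : 0 ≤ x⁻ - s := sub_nonneg.mpr hsx
      have hle : w ≤ (x⁺ - r) + (x⁻ - s) := inf_le_left.trans (by
        refine sup_le ((sub_le_self _ hb).trans (le_add_of_nonneg_right hb)) ?_
        rw [neg_sub]
        exact (sub_le_self _ ha).trans (le_add_of_nonneg_left ha))
      have h1 : w ⊓ (x⁺ - r) = 0 := by
        have h0 : 0 ≤ w ⊓ (x⁺ - r) := le_inf hw0 ha
        exact key ⟨⟨hrB, hr0, hrx⟩, hr⟩ _ (hsolid (y := w)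
          (by rw [abs_of_nonneg h0, abs_of_nonneg hw0]; exact inf_le_left) hwB) h0 inf_le_right
      have h2 : w ⊓ (x⁻ - s) = 0 := by
        have h0 : 0 ≤ w ⊓ (x⁻ - s) := le_inf hw0 hb
        exact key ⟨⟨hsB, hs0, hsx⟩, hs⟩ _ (hsolid (y := w)
          (by rw [abs_of_nonneg h0, abs_of_nonneg hw0]; exact inf_le_left) hwB) h0 inf_le_right
      refine le_antisymm ?_ hw0
      -- Since `w` lies below the sum of two elements and is disjoint from the second, it lies below
      -- the first, from which it is disjoint too.
      have h3 : w - (x⁺ - r) ≤ w ⊓ (x⁻ - s) :=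
        le_inf (sub_le_self _ ha) (sub_le_iff_le_add'.mpr hle)
      rw [h2, sub_nonpos] at h3
      rw [← h1]
      exact le_inf le_rfl h3
    · conv_lhs => rw [← posPart_sub_negPart x]
      abel

end ProjectionBand

/-! ### Monotonicity and absolute values for positive multilinear maps -/

section PositiveMultilinear

variable {E F : Type*} [AddCommGroup E] [Module ℝ E] [Lattice E] [IsOrderedAddMonoid E]
  [AddCommGroup F] [Module ℝ F] [Lattice F] [IsOrderedAddMonoid F] {n : ℕ}

theorem MultilinearMap.apply_mono_of_nonneg {T : MultilinearMap ℝ (fun _ : Fin n => E) F}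
    (hT : 0 ≤ T) {v w : Fin n → E} (hv : ∀ i, 0 ≤ v i) (hvw : ∀ i, v i ≤ w i) : T v ≤ T w := by
  classical
  suffices h : ∀ s : Finset (Fin n), T v ≤ T (s.piecewise w v) by simpa using h Finset.univ
  intro s
  induction s using Finset.induction_on with
  | empty => simp
  | insert a s ha ih =>
    refine ih.trans ?_
    rw [Finset.piecewise_insert]
    set u := s.piecewise w v with hu
    have hu0 : ∀ i, 0 ≤ u i := fun i => by
      by_cases hi : i ∈ s
      · simpa [hu, hi] using (hv i).trans (hvw i)
      · simpa [hu, hi] using hv i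
    have hua : u a = v a := by simp [hu, ha]
    rw [← sub_nonneg]
    have h1 : T (Function.update u a (w a)) - T u = T (Function.update u a (w a - u a)) := by
      rw [T.map_update_sub]; simp
    rw [h1]
    refine hT _ fun i => ?_
    by_cases hi : i = a
    · subst hi; simpa [hua] using hvw i
    · simpa [hi] using hu0 i

/-- Split one variable at a time into positive and negative parts: the values at the two parts are
subtracted in `T v` and added in `T |v|`. -/
theorem MultilinearMap.abs_apply_le_of_nonneg {T : MultilinearMap ℝ (fun _ : Fin n => E) F}
    (hT : 0 ≤ T) (v : Fin n → E) : |T v| ≤ T fun i => |v i| := by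
  classical
  suffices h : ∀ s : Finset (Fin n), ∀ v : Fin n → E, (∀ i, i ∉ s → 0 ≤ v i) →
      |T v| ≤ T fun i => |v i| from h Finset.univ v (by simp)
  intro s
  induction s using Finset.induction_on with
  | empty =>
    intro v hv
    have h0 : ∀ i, 0 ≤ v i := fun i => hv i (by simp)
    rw [abs_of_nonneg (show 0 ≤ T v from hT v h0)]
    simp_rw [fun i => abs_of_nonneg (h0 i)]
    exact le_rfl
  | insert a s ha ih =>
    intro v hv
    have hupd : ∀ x : E, 0 ≤ x → ∀ i, i ∉ s → 0 ≤ Function.update v a x i := by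
      intro x hx i hi
      by_cases hia : i = a
      · subst hia; simpa using hx
      · simpa [hia] using hv i (by simp [hia, hi])
    have habs : ∀ x : E, 0 ≤ x → (fun i => |Function.update v a x i|) =
        Function.update (fun i => |v i|) a x := by
      intro x hx
      ext i
      by_cases hia : i = a
      · subst hia; simp [abs_of_nonneg hx]
      · simp [hia]
    have h1 := ih _ (hupd _ (posPart_nonneg (v a)))
    have h2 := ih _ (hupd _ (negPart_nonneg (v a)))
    rw [habs _ (posPart_nonneg _)] at h1
    rw [habs _ (negPart_nonneg _)] at h2
    have h3 : T v = T (Function.update v a (v a)⁺) - T (Function.update v a (v a)⁻) := by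
      rw [← T.map_update_sub, posPart_sub_negPart, Function.update_eq_self]
    have h4 : T (fun i => |v i|) = T (Function.update (fun i => |v i|) a (v a)⁺) +
        T (Function.update (fun i => |v i|) a (v a)⁻) := by
      rw [← T.map_update_add, posPart_add_negPart, Function.update_eq_self_iff.mpr rfl]
    rw [h3, h4]
    refine abs_le'.mpr ⟨?_, ?_⟩
    · rw [sub_eq_add_neg]
      exact add_le_add ((le_abs_self _).trans h1) ((neg_le_abs _).trans h2)
    · rw [neg_sub, sub_eq_add_neg, add_comm]
      exact add_le_add ((neg_le_abs _).trans h1) ((le_abs_self _).trans h2)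

theorem IsPosPoly.apply_mono {P : E → F} (hP : IsPosPoly n P) {x y : E} (hx : 0 ≤ x)
    (hxy : x ≤ y) : P x ≤ P y := by
  obtain ⟨T, hT, hT0⟩ := hP
  rw [hT.2, hT.2]
  exact MultilinearMap.apply_mono_of_nonneg hT0 (fun _ => hx) fun _ => hxy

theorem IsPosPoly.apply_nonneg {P : E → F} (hP : IsPosPoly n P) {x : E} (hx : 0 ≤ x) :
    0 ≤ P x := by
  obtain ⟨T, hT, hT0⟩ := hP
  rw [hT.2]
  exact hT0 _ fun _ => hx

theorem IsPosPoly.abs_apply_le {P : E → F} (hP : IsPosPoly n P) (x : E) : |P x| ≤ P |x| := by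
  obtain ⟨T, hT, hT0⟩ := hP
  rw [hT.2, hT.2]
  exact MultilinearMap.abs_apply_le_of_nonneg hT0 _

end PositiveMultilinear

/-! ### Norm estimates for positive polynomials -/

section BanachLattice

variable {n : ℕ} {E F : Type*} [NormedAddCommGroup E] [NormedSpace ℝ E] [Lattice E]
  [IsOrderedAddMonoid E] [IsOrderedModule ℝ E] [HasSolidNorm E]
  [NormedAddCommGroup F] [NormedSpace ℝ F] [Lattice F]
  [IsOrderedAddMonoid F] [IsOrderedModule ℝ F] [HasSolidNorm F]

theorem IsPosPoly.norm_apply_le {P : E → F} (hP : IsPosPoly n P) (x : E) : ‖P x‖ ≤ ‖P |x|‖ := by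
  refine norm_le_norm_of_abs_le_abs ((hP.abs_apply_le x).trans (le_abs_self _))

/-- A positive homogeneous polynomial on a Banach lattice is bounded on the unit ball. -/
theorem IsPosPoly.bddAbove [CompleteSpace E] {P : E → F} (hP : IsPosPoly n P) :
    BddAbove {r : ℝ | ∃ x : E, ‖x‖ ≤ 1 ∧ r = ‖P x‖} := by
  by_contra hb
  -- The growth rate is chosen so that at `2⁻ᵏ |x k|` the norm of `P` still exceeds `k`. All these
  -- points lie below one sum `s`, so monotonicity would give `‖P s‖ > k` for every `k`.
  have h1 : ∀ k : ℕ, ∃ x : E, ‖x‖ ≤ 1 ∧ ((2 : ℝ) ^ k) ^ n * k < ‖P x‖ := by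
    intro k
    obtain ⟨_, ⟨x, hx, rfl⟩, h⟩ := not_bddAbove_iff.mp hb (((2 : ℝ) ^ k) ^ n * k)
    exact ⟨x, hx, h⟩
  choose x hx hPx using h1
  have hterm : ∀ k, 0 ≤ ((1 / 2 : ℝ) ^ k) • |x k| := fun k =>
    smul_nonneg (by positivity) (abs_nonneg _)
  have hsum : Summable fun k => ((1 / 2 : ℝ) ^ k) • |x k| := by
    refine Summable.of_norm_bounded summable_geometric_two fun k => ?_
    rw [norm_smul, norm_abs_eq_norm, Real.norm_of_nonneg (by positivity)]
    exact mul_le_of_le_one_right (by positivity) (hx k)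
  set s := ∑' k, ((1 / 2 : ℝ) ^ k) • |x k| with hs
  obtain ⟨k, hk⟩ := exists_nat_gt ‖P s‖
  have h2 : P (((1 / 2 : ℝ) ^ k) • |x k|) ≤ P s :=
    hP.apply_mono (hterm k) (hsum.le_tsum k fun j _ => hterm j)
  have h3 : ‖P (((1 / 2 : ℝ) ^ k) • |x k|)‖ ≤ ‖P s‖ := by
    refine norm_le_norm_of_abs_le_abs ?_
    rw [abs_of_nonneg (hP.apply_nonneg (hterm k))]
    exact h2.trans (le_abs_self _)
  obtain ⟨T, hT, -⟩ := id hP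
  rw [hT.map_smul, norm_smul, Real.norm_of_nonneg (by positivity)] at h3
  have h4 := (hPx k).trans_le (hP.norm_apply_le (x k))
  have h5 : ((1 / 2 : ℝ) ^ k) ^ n * (((2 : ℝ) ^ k) ^ n * k) = k := by
    rw [← mul_assoc, ← mul_pow, ← mul_pow]
    norm_num
  have h6 := mul_lt_mul_of_pos_left h4 (show (0 : ℝ) < ((1 / 2 : ℝ) ^ k) ^ n by positivity)
  rw [h5] at h6
  linarith

theorem polyNorm_nonneg (P : E → F) : 0 ≤ polyNorm P := by
  refine Real.sSup_nonneg ?_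
  rintro _ ⟨x, -, rfl⟩
  exact norm_nonneg _

/-- If `Q ≥ |P|` then `‖P‖ ≤ ‖Q‖`. -/
theorem polyNorm_le_of_dominated [CompleteSpace E] {P Q : E → F} (h₁ : IsPosPoly n (Q - P))
    (h₂ : IsPosPoly n (Q + P)) : polyNorm P ≤ polyNorm Q := by
  have hQ : IsPosPoly n Q := by
    have := (h₁.add h₂).smul (c := (1 / 2 : ℝ)) (by norm_num)
    have h : (1 / 2 : ℝ) • (Q - P + (Q + P)) = Q := by
      rw [show Q - P + (Q + P) = (2 : ℝ) • Q by rw [two_smul]; abel, smul_smul]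
      norm_num
    rwa [h] at this
  refine polyNorm_le fun x hx => ?_
  -- Write `2P = (Q + P) - (Q - P)`; bounding both positive polynomials by their values at `|x|`
  -- adds up to `2Q |x|`.
  have h3 : |(2 : ℝ) • P x| ≤ |(2 : ℝ) • Q (|x|)| := by
    have ha := h₁.abs_apply_le x
    have hb := h₂.abs_apply_le x
    simp only [Pi.sub_apply, Pi.add_apply] at ha hb
    have e1 : (2 : ℝ) • P x = (Q x + P x) + -(Q x - P x) := by rw [two_smul]; abel
    have e2 : (2 : ℝ) • Q |x| = (Q |x| + P |x|) + (Q |x| - P |x|) := by rw [two_smul]; abel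
    refine le_trans ?_ (le_abs_self _)
    rw [e1, e2]
    refine abs_le'.mpr ⟨?_, ?_⟩
    · exact add_le_add ((le_abs_self _).trans hb) ((neg_le_abs _).trans ha)
    · rw [neg_add, neg_neg]
      exact add_le_add ((neg_le_abs _).trans hb) ((le_abs_self _).trans ha)
  have h4 := norm_le_norm_of_abs_le_abs h3
  rw [norm_smul, norm_smul] at h4
  have h5 : ‖P x‖ ≤ ‖Q |x|‖ := le_of_mul_le_mul_left h4 (by norm_num)
  exact h5.trans (le_csSup hQ.bddAbove ⟨|x|, by rwa [norm_abs_eq_norm], rfl⟩)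

theorem DominatesAbs.polyNorm_le [CompleteSpace E] {P Q : RegPoly n E F}
    (h : DominatesAbs Q P) : polyNorm P.toFun ≤ polyNorm Q.toFun := by
  refine polyNorm_le_of_dominated h.1 ?_
  have := h.2
  rwa [RegPoly.le_def, RegPoly.toFun_neg, sub_neg_eq_add] at this

theorem RegPoly.polyNorm_mono [CompleteSpace E] {P Q : RegPoly n E F} (hP : 0 ≤ P)
    (hPQ : P ≤ Q) : polyNorm P.toFun ≤ polyNorm Q.toFun :=
  DominatesAbs.polyNorm_le ⟨hPQ, (neg_nonpos.mpr hP).trans (hP.trans hPQ)⟩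

/-- Positive polynomials are closed under pointwise limits. -/
theorem IsPosPoly.of_tendsto {ι : Type*} {l : Filter ι} [l.NeBot] {P : ι → E → F} {Q : E → F}
    (hP : ∀ i, IsPosPoly n (P i)) (h : ∀ x, Filter.Tendsto (fun i => P i x) l (nhds (Q x))) :
    IsPosPoly n Q := by
  choose T hT hT0 using hP
  obtain ⟨S, hS, hlim⟩ := IsAssociated.of_tendsto hT h
  exact ⟨S, hS, fun v hv => ge_of_tendsto' (hlim v) fun i => hT0 i v hv⟩

end BanachLattice

/-! ### Completeness of the space of continuous polynomials -/

section Complete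

variable {n : ℕ} {E F : Type*} [NormedAddCommGroup E] [NormedSpace ℝ E]
  [NormedAddCommGroup F] [NormedSpace ℝ F]

/-- The inclusion of the continuous polynomials into the space of all functions. -/
def ContPoly.toFunLinear : ContPoly n E F →ₗ[ℝ] E → F := (contPolySubmodule n E F).subtype

theorem ContPoly.toFunLinear_apply (P : ContPoly n E F) : ContPoly.toFunLinear P = P.toFun := rfl

theorem ContPoly.norm_def (P : ContPoly n E F) : ‖P‖ = polyNorm P.toFun := rfl

theorem ContPoly.toFun_sub (P Q : ContPoly n E F) : (P - Q).toFun = P.toFun - Q.toFun := rfl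

/-- Homogeneity after rescaling `x` into the unit ball; dividing by `‖x‖ + 1` avoids a separate case
`x = 0`. -/
theorem ContPoly.norm_apply_le_mul (P : ContPoly n E F) (x : E) :
    ‖P.toFun x‖ ≤ (‖x‖ + 1) ^ n * ‖P‖ := by
  obtain ⟨T, hT⟩ := P.2.1
  have hr : 0 < ‖x‖ + 1 := by positivity
  have h1 : ‖(‖x‖ + 1)⁻¹ • x‖ ≤ 1 := by
    rw [norm_smul, norm_inv, Real.norm_of_nonneg hr.le, inv_mul_eq_div, div_le_one hr]
    linarith
  have h2 := P.norm_apply_le h1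
  have h3 : P.toFun x = (‖x‖ + 1) ^ n • P.toFun ((‖x‖ + 1)⁻¹ • x) := by
    rw [← IsAssociated.map_smul (P := P.toFun) hT, smul_inv_smul₀ hr.ne']
  rw [h3, norm_smul, Real.norm_of_nonneg (by positivity)]
  exact mul_le_mul_of_nonneg_left h2 (by positivity)

theorem ContPoly.tendsto_apply {ι : Type*} {l : Filter ι} {P : ι → ContPoly n E F}
    {Q : ContPoly n E F} (h : Filter.Tendsto P l (nhds Q)) (x : E) :
    Filter.Tendsto (fun i => (P i).toFun x) l (nhds (Q.toFun x)) := by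
  rw [tendsto_iff_norm_sub_tendsto_zero] at h ⊢
  refine squeeze_zero (fun _ => norm_nonneg _) (fun i => (P i - Q).norm_apply_le_mul x) ?_
  simpa using h.const_mul ((‖x‖ + 1) ^ n)

instance [CompleteSpace F] : CompleteSpace (ContPoly n E F) := by
  refine Metric.complete_of_cauchySeq_tendsto fun P hP => ?_
  have hC : ∀ ε : ℝ, 0 < ε → ∃ N, ∀ k ≥ N, ∀ l ≥ N, ‖P k - P l‖ < ε := by
    intro ε hε
    obtain ⟨N, hN⟩ := Metric.cauchySeq_iff.mp hP ε hε
    exact ⟨N, fun k hk l hl => by rw [← dist_eq_norm]; exact hN k hk l hl⟩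
  have hpt : ∀ x, ∃ y, Filter.Tendsto (fun k => (P k).toFun x) Filter.atTop (nhds y) := by
    intro x
    refine cauchySeq_tendsto_of_complete (Metric.cauchySeq_iff.mpr fun ε hε => ?_)
    have hr : 0 < (‖x‖ + 1) ^ n := by positivity
    obtain ⟨N, hN⟩ := hC (ε / (‖x‖ + 1) ^ n) (by positivity)
    refine ⟨N, fun k hk l hl => ?_⟩
    rw [dist_eq_norm]
    refine ((P k - P l).norm_apply_le_mul x).trans_lt ?_
    rw [mul_comm, ← lt_div_iff₀ hr]
    exact hN k hk l hl
  choose Q hQ using hpt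
  have hunif : ∀ ε : ℝ, 0 < ε → ∃ N, ∀ k ≥ N, ∀ x, ‖Q x - (P k).toFun x‖ ≤ (‖x‖ + 1) ^ n * ε := by
    intro ε hε
    obtain ⟨N, hN⟩ := hC ε hε
    refine ⟨N, fun k hk x => ?_⟩
    refine le_of_tendsto ((hQ x).sub_const _).norm ?_
    filter_upwards [Filter.eventually_ge_atTop N] with l hl
    exact ((P l - P k).norm_apply_le_mul x).trans
      (mul_le_mul_of_nonneg_left (hN l hl k hk).le (by positivity))
  have hcont : Continuous Q := by
    have hloc : TendstoLocallyUniformly (fun k => (P k).toFun) Q Filter.atTop := by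
      rw [Metric.tendstoLocallyUniformly_iff]
      intro ε hε x
      -- On the unit ball around `x` one has `‖y‖ + 1 ≤ ‖x‖ + 1 + 1`, so this tolerance gives a
      -- uniform error `ε / 2` there.
      obtain ⟨N, hN⟩ := hunif (ε / 2 / (‖x‖ + 1 + 1) ^ n) (by positivity)
      refine ⟨Metric.ball x 1, Metric.ball_mem_nhds x one_pos, ?_⟩
      filter_upwards [Filter.eventually_ge_atTop N] with k hk y hy
      rw [dist_eq_norm]
      refine (hN k hk y).trans_lt ?_
      have hy' : ‖y‖ ≤ ‖x‖ + 1 := by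
        have h1 := norm_le_norm_add_norm_sub' y x
        rw [Metric.mem_ball, dist_eq_norm] at hy
        linarith
      have h2 : (‖y‖ + 1) ^ n ≤ (‖x‖ + 1 + 1) ^ n := by gcongr
      calc (‖y‖ + 1) ^ n * (ε / 2 / (‖x‖ + 1 + 1) ^ n)
          ≤ (‖x‖ + 1 + 1) ^ n * (ε / 2 / (‖x‖ + 1 + 1) ^ n) := by gcongr
        _ = ε / 2 := by field_simp
        _ < ε := by linarith
    exact hloc.continuous (Filter.Frequently.of_forall fun k => (P k).2.2)
  have hassoc : ∀ k, ∃ T : MultilinearMap ℝ (fun _ : Fin n => E) F,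
      IsAssociated T (P k).toFun := fun k => (P k).2.1
  choose T hT using hassoc
  obtain ⟨S, hS, -⟩ := IsAssociated.of_tendsto hT hQ
  have hmem : Q ∈ contPolySubmodule n E F := ⟨⟨S, hS⟩, hcont⟩
  let R : ContPoly n E F := (⟨Q, hmem⟩ : contPolySubmodule n E F)
  refine ⟨R, ?_⟩
  rw [tendsto_iff_norm_sub_tendsto_zero, Metric.tendsto_atTop]
  intro ε hε
  obtain ⟨N, hN⟩ := hunif (ε / 2 / 2 ^ n) (by positivity)
  refine ⟨N, fun k hk => ?_⟩
  rw [dist_zero_right, norm_norm]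
  refine lt_of_le_of_lt (polyNorm_le (C := ε / 2) fun x hx => ?_) (by linarith)
  change ‖(P k).toFun x - Q x‖ ≤ _
  rw [norm_sub_rev]
  refine (hN k hk x).trans ?_
  have h2 : (‖x‖ + 1) ^ n ≤ 2 ^ n := by gcongr; linarith
  calc (‖x‖ + 1) ^ n * (ε / 2 / 2 ^ n) ≤ 2 ^ n * (ε / 2 / 2 ^ n) := by gcongr
    _ = ε / 2 := by field_simp

end Complete

/-! ### Rosenthal's lemma -/

section Rosenthal

/-- Rosenthal's lemma, with row sums bounded by a multiple of `δ`. -/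
theorem exists_injective_offDiag_sum_le_aux {δ : ℝ} (hδ : 0 ≤ δ) (N : ℕ) :
    ∀ m : ℕ → ℕ → ℝ, (∀ j k, 0 ≤ m j k) →
      (∀ (j : ℕ) (S : Finset ℕ), j ∉ S → ∑ k ∈ S, m j k ≤ N * δ) →
      ∃ σ : ℕ → ℕ, Function.Injective σ ∧
        ∀ (j : ℕ) (S : Finset ℕ), j ∉ S → ∑ k ∈ S, m (σ j) (σ k) ≤ δ := by
  classical
  induction N with
  | zero =>
    intro m _ h
    exact ⟨id, Function.injective_id, fun j S hj => (h j S hj).trans (by simpa using hδ)⟩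
  | succ N ih =>
    intro m hm h
    -- The pairing splits `ℕ` into infinitely many infinite blocks `e p`. Either some block already
    -- works, or every block has a row `i p` with off-diagonal sum above `δ` inside its own block.
    let e : ℕ → ℕ → ℕ := fun p i => Nat.pair p i
    have he : ∀ {p i q j}, e p i = e q j ↔ p = q ∧ i = j := Nat.pair_eq_pair
    by_cases hp : ∃ p, ∀ (i : ℕ) (S : Finset ℕ), i ∉ S → ∑ k ∈ S, m (e p i) (e p k) ≤ δ
    · obtain ⟨p, hp⟩ := hp
      exact ⟨e p, fun i j hij => (he.mp hij).2, hp⟩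
    · push Not at hp
      choose i S hiS hS using hp
      obtain ⟨σ, hσ, hσ'⟩ := ih (fun p q => m (e p (i p)) (e q (i q))) (fun _ _ => hm _ _) (by
        intro p R hpR
        -- The bad part `S p` uses up more than `δ` of the row bound `(N + 1) δ`, leaving at most `N
        -- δ` for the representatives of the other blocks.
        have h1 := h (e p (i p)) (R.image (fun q => e q (i q)) ∪ (S p).image (e p)) (by
          simp only [Finset.mem_union, Finset.mem_image, not_or, not_exists, not_and]
          refine ⟨fun q hq hqp => ?_, fun k hk hkp => ?_⟩
          · exact hpR ((he.mp hqp).1 ▸ hq)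
          · exact hiS p ((he.mp hkp).2 ▸ hk))
        rw [Finset.sum_union, Finset.sum_image (fun a _ b _ hab => (he.mp hab).1),
          Finset.sum_image (fun a _ b _ hab => (he.mp hab).2)] at h1
        · have h2 := hS p
          push_cast at h1
          linarith
        · rw [Finset.disjoint_left]
          simp only [Finset.mem_image, not_exists, not_and]
          rintro _ ⟨q, hq, rfl⟩ k hk hkq
          exact hpR ((he.mp hkq).1 ▸ hq))
      exact ⟨fun p => e (σ p) (i (σ p)), fun p q hpq => hσ (he.mp hpq).1, hσ'⟩

/-- Rosenthal's lemma. -/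
theorem exists_injective_offDiag_sum_le {m : ℕ → ℕ → ℝ} (hm : ∀ j k, 0 ≤ m j k) {C : ℝ}
    (hC : ∀ (j : ℕ) (S : Finset ℕ), ∑ k ∈ S, m j k ≤ C) {δ : ℝ} (hδ : 0 < δ) :
    ∃ σ : ℕ → ℕ, Function.Injective σ ∧
      ∀ (j : ℕ) (S : Finset ℕ), j ∉ S → ∑ k ∈ S, m (σ j) (σ k) ≤ δ := by
  obtain ⟨N, hN⟩ := exists_nat_ge (C / δ)
  exact exists_injective_offDiag_sum_le_aux hδ.le N m hm fun j S _ =>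
    (hC j S).trans ((div_le_iff₀ hδ).mp hN)

end Rosenthal

/-! ### Convergence and lower estimates of `c₀` type -/

section CZero

variable {X : Type*} [NormedAddCommGroup X] [NormedSpace ℝ X]

/-- Outside the finite set where `|a k| ≥ ε / (C + 1)`, every finite sum has norm at most `ε C / (C
+ 1) < ε`. -/
theorem summable_smul_of_tendsto_zero [CompleteSpace X] {ι : Type*} {w : ι → X} {C : ℝ}
    (hC : ∀ (t : Finset ι) (a : ι → ℝ) (c : ℝ), (∀ k ∈ t, |a k| ≤ c) → 0 ≤ c →
      ‖∑ k ∈ t, a k • w k‖ ≤ c * C)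
    {a : ι → ℝ} (ha : Filter.Tendsto a Filter.cofinite (nhds 0)) :
    Summable fun k => a k • w k := by
  classical
  rw [summable_iff_vanishing_norm]
  intro ε hε
  have hC0 : 0 ≤ C := by simpa using hC ∅ 0 1 (by simp) zero_le_one
  have hη : 0 < ε / (C + 1) := by positivity
  have hfin : {k | ¬ |a k| < ε / (C + 1)}.Finite := by
    have := ha.eventually (Metric.ball_mem_nhds 0 hη)
    simpa [Filter.eventually_cofinite] using this
  refine ⟨hfin.toFinset, fun t ht => ?_⟩
  refine (hC t a (ε / (C + 1)) (fun k hk => ?_) hη.le).trans_lt ?_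
  · by_contra hk'
    exact Finset.disjoint_left.mp ht hk (hfin.mem_toFinset.mpr fun h => hk' h.le)
  · rw [div_mul_eq_mul_div, div_lt_iff₀ (by positivity)]
    nlinarith

/-- A sequence that is bounded away from zero and whose sums with bounded coefficients are
uniformly bounded has a subsequence that admits a lower `c₀`-estimate. -/
theorem exists_injective_lower_estimate [CompleteSpace X] {w : ℕ → X} {C : ℝ}
    (hC : ∀ (t : Finset ℕ) (a : ℕ → ℝ) (c : ℝ), (∀ k ∈ t, |a k| ≤ c) → 0 ≤ c →
      ‖∑ k ∈ t, a k • w k‖ ≤ c * C)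
    {ε : ℝ} (hε : 0 < ε) (hw : ∀ k, ε ≤ ‖w k‖) :
    ∃ σ : ℕ → ℕ, Function.Injective σ ∧ ∀ (a : ℕ → ℝ) (c : ℝ),
      (∀ k, |a k| ≤ c) → ∀ x, HasSum (fun k => a k • w (σ k)) x →
        ∀ j, ε * |a j| ≤ ‖x‖ + ε / 2 * c := by
  choose g hg1 hg using fun k => exists_dual_vector'' ℝ (w k)
  have hgle : ∀ k x, |g k x| ≤ ‖x‖ := fun k x => by
    have := (g k).le_opNorm x
    rw [Real.norm_eq_abs] at this
    exact this.trans (mul_le_of_le_one_left (norm_nonneg _) (hg1 k))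
  obtain ⟨σ, hσ, hrow⟩ := exists_injective_offDiag_sum_le (m := fun j k => |g j (w k)|)
    (fun _ _ => abs_nonneg _) (C := C) (fun j S => by
      -- Signs as coefficients turn the row sum into one value of `g j`, bounded by `C` through the
      -- hypothesis with `c = 1`.
      have h1 : ∑ k ∈ S, |g j (w k)| = g j (∑ k ∈ S, (SignType.sign (g j (w k)) : ℝ) • w k) := by
        rw [map_sum]
        refine Finset.sum_congr rfl fun k _ => ?_
        rw [map_smul, smul_eq_mul, sign_mul_self]
      rw [h1]
      refine (le_abs_self _).trans ((hgle _ _).trans ?_)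
      have h2 := hC S (fun k => (SignType.sign (g j (w k)) : ℝ)) 1 (fun k _ => by
        rcases SignType.sign (g j (w k)) <;> simp) zero_le_one
      simpa using h2) (half_pos hε)
  refine ⟨σ, hσ, fun a c hac x hx j => ?_⟩
  classical
  have hc : 0 ≤ c := (abs_nonneg _).trans (hac 0)
  have h1 : HasSum (fun k => a k * g (σ j) (w (σ k))) (g (σ j) x) := by
    have := (g (σ j)).hasSum hx
    simpa using this
  -- The norming functional reads off the diagonal term; Rosenthal's lemma controls all the others.
  have h2 : |g (σ j) x - a j * ‖w (σ j)‖| ≤ ε / 2 * c := by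
    refine le_of_tendsto (((h1 : Filter.Tendsto _ _ _).sub_const (a j * ‖w (σ j)‖)).abs) ?_
    filter_upwards [Filter.eventually_ge_atTop ({j} : Finset ℕ)] with S hS
    have hjS : j ∈ S := by simpa using hS
    have h3 : g (σ j) (w (σ j)) = ‖w (σ j)‖ := by simpa using hg (σ j)
    rw [← Finset.add_sum_erase S _ hjS, h3, add_sub_cancel_left]
    refine (Finset.abs_sum_le_sum_abs _ _).trans ?_
    calc ∑ k ∈ S.erase j, |a k * g (σ j) (w (σ k))|
        ≤ ∑ k ∈ S.erase j, c * |g (σ j) (w (σ k))| := by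
          refine Finset.sum_le_sum fun k _ => ?_
          rw [abs_mul]
          exact mul_le_mul_of_nonneg_right (hac k) (abs_nonneg _)
      _ = c * ∑ k ∈ S.erase j, |g (σ j) (w (σ k))| := by rw [Finset.mul_sum]
      _ ≤ c * (ε / 2) := mul_le_mul_of_nonneg_left (hrow j _ (Finset.notMem_erase j S)) hc
      _ = ε / 2 * c := mul_comm _ _
  have h4 : |a j * ‖w (σ j)‖| ≤ |g (σ j) x| + ε / 2 * c := by
    have := abs_sub_abs_le_abs_sub (a j * ‖w (σ j)‖) (g (σ j) x)
    rw [abs_sub_comm] at this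
    linarith
  rw [abs_mul, abs_norm] at h4
  have h5 := mul_le_mul_of_nonneg_left (hw (σ j)) (abs_nonneg (a j))
  have h6 := hgle (σ j) x
  linarith

end CZero

/-! ### `A^r` as an order ideal -/

section RegSpan

variable {n : ℕ} {E F : Type*} [NormedAddCommGroup E] [NormedSpace ℝ E] [Lattice E]
  [IsOrderedAddMonoid E] [NormedAddCommGroup F] [NormedSpace ℝ F] [Lattice F]
  [IsOrderedAddMonoid F] [IsOrderedModule ℝ F] {A : Submodule ℝ (ContPoly n E F)}

theorem BelongsTo.zero : BelongsTo A (0 : E → F) := ⟨0, A.zero_mem, rfl⟩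

theorem BelongsTo.add {P Q : E → F} (hP : BelongsTo A P) (hQ : BelongsTo A Q) :
    BelongsTo A (P + Q) := by
  obtain ⟨a, ha, rfl⟩ := hP
  obtain ⟨b, hb, rfl⟩ := hQ
  exact ⟨a + b, A.add_mem ha hb, rfl⟩

theorem BelongsTo.smul {P : E → F} (c : ℝ) (hP : BelongsTo A P) : BelongsTo A (c • P) := by
  obtain ⟨a, ha, rfl⟩ := hP
  exact ⟨c • a, A.smul_mem c ha, rfl⟩

theorem belongsTo_of_mem_regSpan {P : RegPoly n E F} (hP : P ∈ regSpan A) :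
    BelongsTo A P.toFun := by
  induction hP using Submodule.span_induction with
  | mem P h => exact h.2
  | zero => exact .zero
  | add P Q _ _ hP hQ => exact hP.add hQ
  | smul c P _ hP => exact hP.smul c

theorem mem_regSpan_of_nonneg {P : RegPoly n E F} (h0 : 0 ≤ P) (h : BelongsTo A P.toFun) :
    P ∈ regSpan A := Submodule.subset_span ⟨h0, h⟩

theorem dominatesAbs_self_of_nonneg {P : RegPoly n E F} (h0 : 0 ≤ P) : DominatesAbs P P :=
  ⟨le_rfl, (neg_nonpos.mpr h0).trans h0⟩

theorem positivePart_add {P Q : RegPoly n E F} (hP : P ∈ positivePart A)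
    (hQ : Q ∈ positivePart A) : P + Q ∈ positivePart A :=
  ⟨add_nonneg hP.1 hQ.1, hP.2.add hQ.2⟩

theorem exists_dominatesAbs_of_mem_regSpan {P : RegPoly n E F} (hP : P ∈ regSpan A) :
    ∃ Q ∈ positivePart A, DominatesAbs Q P := by
  induction hP using Submodule.span_induction with
  | mem P h => exact ⟨P, h, dominatesAbs_self_of_nonneg h.1⟩
  | zero => exact ⟨0, ⟨le_rfl, .zero⟩, dominatesAbs_self_of_nonneg le_rfl⟩
  | add P P' _ _ hP hP' =>
    obtain ⟨Q, hQ, h⟩ := hP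
    obtain ⟨Q', hQ', h'⟩ := hP'
    refine ⟨Q + Q', positivePart_add hQ hQ', add_le_add h.1 h'.1, ?_⟩
    rw [neg_add]
    exact add_le_add h.2 h'.2
  | smul c P _ hP =>
    obtain ⟨Q, hQ, h⟩ := hP
    rcases le_total 0 c with hc | hc
    · refine ⟨c • Q, ⟨smul_nonneg hc hQ.1, hQ.2.smul c⟩, smul_le_smul_of_nonneg_left h.1 hc, ?_⟩
      rw [← smul_neg]
      exact smul_le_smul_of_nonneg_left h.2 hc
    · have hc' : 0 ≤ -c := neg_nonneg.mpr hc
      refine ⟨(-c) • Q, ⟨smul_nonneg hc' hQ.1, hQ.2.smul (-c)⟩, ?_, ?_⟩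
      · have := smul_le_smul_of_nonneg_left h.2 hc'
        rwa [smul_neg, neg_smul, neg_neg] at this
      · rw [← neg_smul]
        exact smul_le_smul_of_nonneg_left h.1 hc'

/-- Domination applies to `0 ≤ Q - P ≤ 2Q`, and `P = Q - (Q - P)`. -/
theorem mem_regSpan_of_dominatesAbs (hdom : HasDominationProperty A) {P Q : RegPoly n E F}
    (hQ : Q ∈ positivePart A) (h : DominatesAbs Q P) : P ∈ regSpan A := by
  have h1 : 0 ≤ Q - P := sub_nonneg.mpr h.1
  have h2 : 0 ≤ Q + P := by
    have := sub_nonneg.mpr h.2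
    rwa [sub_neg_eq_add] at this
  have hQQ : BelongsTo A (Q + Q).toFun := hQ.2.add hQ.2
  have h3 : Q - P ∈ regSpan A := mem_regSpan_of_nonneg h1 (hdom _ _ h1 (by
    rw [sub_eq_add_neg]
    exact add_le_add_right h.2 Q) hQQ)
  have h5 : P = Q - (Q - P) := by abel
  rw [h5]
  exact Submodule.sub_mem _ (mem_regSpan_of_nonneg hQ.1 hQ.2) h3

theorem isOrderIdeal_regSpan (hdom : HasDominationProperty A) :
    IsOrderIdeal (regSpan A) := by
  rintro P Q ⟨U, V, hU, hV, hUV⟩ hQ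
  obtain ⟨R, hR, hRQ⟩ := exists_dominatesAbs_of_mem_regSpan hQ
  have hVR : V ≤ R := hV.2 (by
    rintro _ (rfl | rfl)
    exacts [hRQ.1, hRQ.2])
  exact mem_regSpan_of_dominatesAbs hdom hR
    ⟨(hU.1 (by simp)).trans (hUV.trans hVR), (hU.1 (by simp)).trans (hUV.trans hVR)⟩

end RegSpan

/-! ### The regular norms and copies of `c₀` -/

section RegularNorm

variable {n : ℕ} {E F : Type*} [NormedAddCommGroup E] [NormedSpace ℝ E] [Lattice E]
  [IsOrderedAddMonoid E] [IsOrderedModule ℝ E] [HasSolidNorm E] [CompleteSpace E]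
  [NormedAddCommGroup F] [NormedSpace ℝ F] [Lattice F]
  [IsOrderedAddMonoid F] [IsOrderedModule ℝ F] [HasSolidNorm F]
  {A : Submodule ℝ (ContPoly n E F)}

theorem regSpanNorm_le {P : regSpan A} {Q : RegPoly n E F} (hQ : Q ∈ positivePart A)
    (h : DominatesAbs Q (P : RegPoly n E F)) : regSpanNorm A P ≤ polyNorm Q.toFun := by
  refine csInf_le ⟨0, ?_⟩ ⟨Q, hQ, h, rfl⟩
  rintro _ ⟨R, -, -, rfl⟩
  exact polyNorm_nonneg _

theorem polyNorm_le_regSpanNorm (P : regSpan A) :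
    polyNorm (P : RegPoly n E F).toFun ≤ regSpanNorm A P := by
  obtain ⟨Q, hQ, h⟩ := exists_dominatesAbs_of_mem_regSpan P.2
  refine le_csInf ⟨_, Q, hQ, h, rfl⟩ ?_
  rintro _ ⟨R, -, hR, rfl⟩
  exact hR.polyNorm_le

/-- The norm of `A^r` is the restriction of the regular norm. -/
theorem regNorm_eq_regSpanNorm (hF : IsDedekindComplete F) (hdom : HasDominationProperty A)
    (P : regSpan A) : regNorm (P : RegPoly n E F) = regSpanNorm A P := by
  obtain ⟨Q, hQ, h⟩ := exists_dominatesAbs_of_mem_regSpan P.2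
  refine le_antisymm ?_ ?_
  · refine csInf_le_csInf ⟨0, ?_⟩ ⟨_, Q, hQ, h, rfl⟩ ?_
    · rintro _ ⟨R, -, -, rfl⟩
      exact polyNorm_nonneg _
    · rintro _ ⟨R, hR, hRP, rfl⟩
      exact ⟨R, hR.1, hRP, rfl⟩
  · refine le_csInf ⟨_, Q, hQ.1, h, rfl⟩ ?_
    rintro _ ⟨R, hR0, hR, rfl⟩
    -- `M = |P|` lies in `A⁺` by domination and is below every competitor `R`, whether or not `R`
    -- belongs to `A`.
    obtain ⟨M, hM⟩ := RegPoly.exists_isLUB_pair hF (P : RegPoly n E F) (-P)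
    have hMP : DominatesAbs M (P : RegPoly n E F) := ⟨hM.1 (by simp), hM.1 (by simp)⟩
    have hle : ∀ {U : RegPoly n E F}, DominatesAbs U (P : RegPoly n E F) → M ≤ U :=
      fun {U} hU => hM.2 (by
        rintro _ (rfl | rfl)
        exacts [hU.1, hU.2])
    have hM0 : 0 ≤ M := by
      have h2 : 0 ≤ (2 : ℝ) • M := by
        have := add_le_add hMP.1 hMP.2
        rwa [add_neg_cancel, ← two_smul ℝ M] at this
      have h3 := smul_nonneg (show (0 : ℝ) ≤ 1 / 2 by norm_num) h2
      rwa [smul_smul, show (1 / 2 : ℝ) * 2 = 1 by norm_num, one_smul] at h3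
    have hMA : M ∈ positivePart A := ⟨hM0, hdom M Q hM0 (hle h) hQ.2⟩
    exact (regSpanNorm_le hMA hMP).trans (RegPoly.polyNorm_mono hM0 (hle hR))

theorem ContainsC0.regNorm_of_regSpanNorm (hF : IsDedekindComplete F)
    (hdom : HasDominationProperty A) (h : ContainsC0 (regSpanNorm A)) :
    ContainsC0 (regNorm : RegPoly n E F → ℝ) := by
  obtain ⟨J, a, b, ha, hb, hJ⟩ := h
  refine ⟨(regSpan A).subtype.comp J, a, b, ha, hb, fun x => ?_⟩
  rw [LinearMap.comp_apply, Submodule.subtype_apply, regNorm_eq_regSpanNorm hF hdom]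
  exact hJ x

theorem ContPoly.toFun_sum_smul {ι : Type*} (t : Finset ι) (a : ι → ℝ) (u : ι → ContPoly n E F) :
    (∑ k ∈ t, a k • u k).toFun = ∑ k ∈ t, a k • (u k).toFun := by
  simp_rw [← ContPoly.toFunLinear_apply, map_sum, map_smul]

theorem IsPosPoly.sum_smul {ι : Type*} {t : Finset ι} {a : ι → ℝ} {P : ι → E → F}
    (ha : ∀ k ∈ t, 0 ≤ a k) (hP : ∀ k, IsPosPoly n (P k)) :
    IsPosPoly n (∑ k ∈ t, a k • P k) := by
  classical
  induction t using Finset.induction_on with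
  | empty => simpa using IsPosPoly.zero n
  | insert k t hk ih =>
    rw [Finset.sum_insert hk]
    exact ((hP k).smul (ha k (by simp))).add (ih fun j hj => ha j (by simp [hj]))

theorem IsPosPoly.hasSum_smul {a : ℕ → ℝ} {u : ℕ → ContPoly n E F} (ha : ∀ k, 0 ≤ a k)
    (hu : ∀ k, IsPosPoly n (u k).toFun) {x : ContPoly n E F}
    (hx : HasSum (fun k => a k • u k) x) : IsPosPoly n x.toFun := by
  refine IsPosPoly.of_tendsto (P := fun s : Finset ℕ => (∑ k ∈ s, a k • u k).toFun)
    (l := Filter.atTop) (fun s => ?_) fun y => ContPoly.tendsto_apply hx y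
  rw [ContPoly.toFun_sum_smul]
  exact IsPosPoly.sum_smul (fun k _ => ha k) hu

/-- Sums of positive polynomials with bounded partial sums are unconditionally bounded. -/
theorem norm_sum_smul_le {u : ℕ → ContPoly n E F} (hu : ∀ k, IsPosPoly n (u k).toFun)
    {P : E → F} (hP : ∀ S : Finset ℕ, IsPosPoly n (P - ∑ k ∈ S, (u k).toFun))
    (t : Finset ℕ) (a : ℕ → ℝ) (c : ℝ) (hac : ∀ k ∈ t, |a k| ≤ c) (hc : 0 ≤ c) :
    ‖∑ k ∈ t, a k • u k‖ ≤ c * polyNorm P := by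
  have h0 : IsPosPoly n P := by simpa using hP ∅
  have h1 : polyNorm (c • P) ≤ c * polyNorm P := by
    refine polyNorm_le fun x hx => ?_
    rw [Pi.smul_apply, norm_smul, Real.norm_of_nonneg hc]
    exact mul_le_mul_of_nonneg_left (le_csSup h0.bddAbove ⟨x, hx, rfl⟩) hc
  refine le_trans ?_ h1
  rw [ContPoly.norm_def, ContPoly.toFun_sum_smul]
  refine polyNorm_le_of_dominated (n := n) ?_ ?_
  -- `c P - ∑ a_k u_k = c (P - ∑ u_k) + ∑ (c - a_k) u_k`, a sum of positive polynomials; the other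
  -- sign is symmetric.
  · have h2 := ((hP t).smul hc).add (IsPosPoly.sum_smul (t := t) (a := fun k => c - a k)
      (fun k hk => sub_nonneg.mpr ((le_abs_self _).trans (hac k hk))) hu)
    convert h2 using 1
    simp_rw [sub_smul, Finset.sum_sub_distrib, smul_sub, Finset.smul_sum]
    abel
  · have h2 := ((hP t).smul hc).add (IsPosPoly.sum_smul (t := t) (a := fun k => c + a k)
      (fun k hk => by linarith [(neg_le_abs _).trans (hac k hk)]) hu)
    convert h2 using 1
    simp_rw [add_smul, Finset.sum_add_distrib, smul_sub, Finset.smul_sum]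
    abel

/-- A sequence in `A⁺` which is bounded away from zero and has order bounded partial sums spans a
copy of `c₀` in `A^r`. -/
theorem containsC0_regSpanNorm [CompleteSpace F] (hA : IsClosed (A : Set (ContPoly n E F)))
    {u : ℕ → ContPoly n E F} (huA : ∀ k, u k ∈ A) (hu : ∀ k, IsPosPoly n (u k).toFun)
    {P : E → F} (hP : ∀ S : Finset ℕ, IsPosPoly n (P - ∑ k ∈ S, (u k).toFun))
    {ε : ℝ} (hε : 0 < ε) (hlow : ∀ k, ε ≤ ‖u k‖) : ContainsC0 (regSpanNorm A) := by
  obtain ⟨σ, hσ, hest⟩ := exists_injective_lower_estimate (norm_sum_smul_le hu hP) hε hlow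
  set w : ℕ → ContPoly n E F := fun k => u (σ k) with hw
  have hwP : ∀ S : Finset ℕ, IsPosPoly n (P - ∑ k ∈ S, (w k).toFun) := by
    classical
    intro S
    have := hP (S.image σ)
    rwa [Finset.sum_image fun a _ b _ h => hσ h] at this
  have hwpos : ∀ k, IsPosPoly n (w k).toFun := fun k => hu (σ k)
  have hC := norm_sum_smul_le hwpos hwP
  have hlim : ∀ x : C₀(ℕ, ℝ), Filter.Tendsto (fun k => x k) Filter.cofinite (nhds 0) := by
    intro x
    have := x.zero_at_infty'
    rwa [Filter.cocompact_eq_cofinite] at this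
  have hsum : ∀ x : C₀(ℕ, ℝ), Summable fun k => x k • w k := fun x =>
    summable_smul_of_tendsto_zero hC (hlim x)
  have hsumabs : ∀ x : C₀(ℕ, ℝ), Summable fun k => |x k| • w k := fun x =>
    summable_smul_of_tendsto_zero hC (by simpa using (hlim x).abs)
  have hxle : ∀ (x : C₀(ℕ, ℝ)) k, |x k| ≤ ‖x‖ := fun x k => by
    have := x.toBCF.norm_coe_le_norm k
    rwa [Real.norm_eq_abs, ZeroAtInftyContinuousMap.norm_toBCF_eq_norm] at this
  set S : C₀(ℕ, ℝ) → ContPoly n E F := fun x => ∑' k, x k • w k with hS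
  -- `M x` dominates `|S x|` and lies in `A⁺`, so it shows that `S x` is in `A^r` and bounds its
  -- regular norm.
  set M : C₀(ℕ, ℝ) → ContPoly n E F := fun x => ∑' k, |x k| • w k with hM
  have hmemA : ∀ (a : ℕ → ℝ) (y : ContPoly n E F), HasSum (fun k => a k • w k) y → y ∈ A :=
    fun a y hy => hA.mem_of_tendsto hy (Filter.Eventually.of_forall fun s =>
      A.sum_mem fun k _ => A.smul_mem _ (huA _))
  have hMpos : ∀ x, IsPosPoly n (M x).toFun := fun x =>
    IsPosPoly.hasSum_smul (fun k => abs_nonneg _) hwpos (hsumabs x).hasSum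
  have hsub : ∀ x, IsPosPoly n ((M x).toFun - (S x).toFun) := fun x => by
    have h := (hsumabs x).hasSum.sub (hsum x).hasSum
    simp_rw [← sub_smul] at h
    exact IsPosPoly.hasSum_smul (fun k => sub_nonneg.mpr (le_abs_self _)) hwpos h
  have hadd : ∀ x, IsPosPoly n ((M x).toFun + (S x).toFun) := fun x => by
    have h := (hsumabs x).hasSum.add (hsum x).hasSum
    simp_rw [← add_smul] at h
    exact IsPosPoly.hasSum_smul (fun k => by linarith [neg_le_abs (x k)]) hwpos h
  have hMnorm : ∀ x, ‖M x‖ ≤ ‖x‖ * polyNorm P := fun x =>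
    le_of_tendsto (hsumabs x).hasSum.norm (Filter.Eventually.of_forall fun s =>
      hC s _ ‖x‖ (fun k _ => by rw [abs_abs]; exact hxle x k) (norm_nonneg _))
  have hreg : ∀ x, (S x).toFun ∈ regPolySubmodule n E F := fun x =>
    ⟨_, _, hMpos x, hsub x, by abel⟩
  let R : C₀(ℕ, ℝ) → RegPoly n E F := fun x =>
    (⟨(S x).toFun, hreg x⟩ : regPolySubmodule n E F)
  have hMmem : ∀ x, RegPoly.ofPos _ (hMpos x) ∈ positivePart A := fun x =>
    ⟨RegPoly.ofPos_nonneg _ _, M x, hmemA _ _ (hsumabs x).hasSum, rfl⟩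
  have hRmem : ∀ x, R x ∈ regSpan A := fun x => by
    have h1 : R x = RegPoly.ofPos _ (hMpos x) - RegPoly.ofPos _ (hsub x) := by
      refine RegPoly.ext ?_
      change (S x).toFun = (M x).toFun - ((M x).toFun - (S x).toFun)
      abel
    rw [h1]
    refine Submodule.sub_mem _ (Submodule.subset_span (hMmem x)) (mem_regSpan_of_nonneg
      (RegPoly.ofPos_nonneg _ _) ⟨M x - S x, A.sub_mem (hmemA _ _ (hsumabs x).hasSum)
        (hmemA _ _ (hsum x).hasSum), rfl⟩)
  have hSadd : ∀ x y, S (x + y) = S x + S y := fun x y => by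
    rw [hS]
    simp only [ZeroAtInftyContinuousMap.add_apply, add_smul]
    exact (hsum x).tsum_add (hsum y)
  have hSsmul : ∀ (c : ℝ) x, S (c • x) = c • S x := fun c x => by
    rw [hS]
    simp only [ZeroAtInftyContinuousMap.smul_apply, smul_eq_mul, mul_smul]
    exact (hsum x).tsum_const_smul c
  let J : C₀(ℕ, ℝ) →ₗ[ℝ] regSpan A :=
    { toFun := fun x => ⟨R x, hRmem x⟩
      map_add' := fun x y => Subtype.ext (RegPoly.ext (by
        change (S (x + y)).toFun = (S x + S y).toFun
        rw [hSadd]))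
      map_smul' := fun c x => Subtype.ext (RegPoly.ext (by
        change (S (c • x)).toFun = (c • S x).toFun
        rw [hSsmul])) }
  -- The lower constant is `ε` less the off-diagonal loss `ε / 2`; the added `1` only keeps the
  -- upper constant positive.
  refine ⟨J, ε / 2, polyNorm P + 1, half_pos hε, by linarith [polyNorm_nonneg P],
    fun x => ⟨?_, ?_⟩⟩
  · refine le_trans ?_ (polyNorm_le_regSpanNorm (J x))
    change ε / 2 * ‖x‖ ≤ ‖S x‖
    have h1 : ∀ k, |x k| ≤ (‖S x‖ + ε / 2 * ‖x‖) / ε := fun k => by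
      rw [le_div_iff₀ hε, mul_comm]
      exact hest (fun k => x k) ‖x‖ (hxle x) (S x) (hsum x).hasSum k
    have h2 : ‖x‖ ≤ (‖S x‖ + ε / 2 * ‖x‖) / ε := by
      rw [← ZeroAtInftyContinuousMap.norm_toBCF_eq_norm]
      refine (BoundedContinuousFunction.norm_le (by positivity)).mpr fun k => ?_
      rw [ZeroAtInftyContinuousMap.norm_toBCF_eq_norm]
      exact h1 k
    rw [le_div_iff₀ hε] at h2
    linarith
  · have hdomJ : DominatesAbs (RegPoly.ofPos _ (hMpos x)) (R x) := by
      refine ⟨hsub x, ?_⟩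
      change IsPosPoly n ((M x).toFun - -(S x).toFun)
      rw [sub_neg_eq_add]
      exact hadd x
    refine (regSpanNorm_le (P := J x) (hMmem x) hdomJ).trans ((hMnorm x).trans ?_)
    rw [mul_comm]
    exact mul_le_mul_of_nonneg_right (by linarith) (norm_nonneg _)

end RegularNorm

/-! ### Greatest minorants in `A⁺` -/

section GreatestMinorant

variable {n : ℕ} {E F : Type*} [NormedAddCommGroup E] [NormedSpace ℝ E] [Lattice E]
  [IsOrderedAddMonoid E] [IsOrderedModule ℝ E] [HasSolidNorm E] [CompleteSpace E]
  [NormedAddCommGroup F] [NormedSpace ℝ F] [Lattice F]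
  [IsOrderedAddMonoid F] [IsOrderedModule ℝ F] [HasSolidNorm F] [CompleteSpace F]
  {A : Submodule ℝ (ContPoly n E F)}

theorem RegPoly.toFun_sum {ι : Type*} (t : Finset ι) (P : ι → RegPoly n E F) :
    (∑ k ∈ t, P k).toFun = ∑ k ∈ t, (P k).toFun :=
  map_sum (regPolySubmodule n E F).subtype P t

variable (A) in
/-- The minorants in `A⁺` of a positive polynomial. -/
def positiveMinorants (P : RegPoly n E F) : Set (RegPoly n E F) :=
  {Q | Q ∈ regSpan A ∧ 0 ≤ Q ∧ Q ≤ P}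

theorem zero_mem_positiveMinorants {P : RegPoly n E F} (hP : 0 ≤ P) :
    0 ∈ positiveMinorants A P := ⟨Submodule.zero_mem _, le_rfl, hP⟩

/-- The supremum of `Q` and `Q'` is at most `Q + Q'`, so domination keeps it in `A`. -/
theorem exists_ge_positiveMinorants (hF : IsDedekindComplete F) (hdom : HasDominationProperty A)
    {P Q Q' : RegPoly n E F} (hQ : Q ∈ positiveMinorants A P) (hQ' : Q' ∈ positiveMinorants A P) :
    ∃ U ∈ positiveMinorants A P, Q ≤ U ∧ Q' ≤ U := by
  obtain ⟨U, hU⟩ := RegPoly.exists_isLUB_pair hF Q Q'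
  have h1 : Q ≤ U := hU.1 (by simp)
  have h2 : Q' ≤ U := hU.1 (by simp)
  have h3 : U ≤ Q + Q' := hU.2 (by
    rintro _ (rfl | rfl)
    exacts [le_add_of_nonneg_right hQ'.2.1, le_add_of_nonneg_left hQ.2.1])
  have h4 : U ≤ P := hU.2 (by
    rintro _ (rfl | rfl)
    exacts [hQ.2.2, hQ'.2.2])
  have h0 : 0 ≤ U := hQ.2.1.trans h1
  exact ⟨U, ⟨mem_regSpan_of_nonneg h0 (hdom U _ h0 h3
    (belongsTo_of_mem_regSpan (Submodule.add_mem _ hQ.1 hQ'.1))), h0, h4⟩, h1, h2⟩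

/-- If `A^r` contains no copy of `c₀`, then the upward directed set of minorants of `P` in `A⁺` is
Cauchy in norm. -/
theorem exists_positiveMinorant_norm_sub_lt (hA : IsClosed (A : Set (ContPoly n E F)))
    (hc : ¬ ContainsC0 (regSpanNorm A)) {P : RegPoly n E F} (hP : 0 ≤ P) {ε : ℝ} (hε : 0 < ε) :
    ∃ Q ∈ positiveMinorants A P, ∀ Q' ∈ positiveMinorants A P, Q ≤ Q' →
      polyNorm (Q' - Q).toFun < ε := by
  by_contra hcon
  push Not at hcon
  -- Iterating `f` from `0` gives an increasing sequence of minorants with every increment of norm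
  -- at least `ε`; the partial sums telescope and stay below `P`.
  choose! f hfmem hfle hfε using hcon
  let q : ℕ → RegPoly n E F := fun k => f^[k] 0
  have hqs : ∀ k, q (k + 1) = f (q k) := fun k => Function.iterate_succ_apply' f k 0
  have hq : ∀ k, q k ∈ positiveMinorants A P := by
    intro k
    induction k with
    | zero => exact zero_mem_positiveMinorants hP
    | succ k ih => rw [hqs]; exact hfmem _ ih
  have hmono : ∀ k, 0 ≤ q (k + 1) - q k := fun k => by
    rw [hqs]; exact sub_nonneg.mpr (hfle _ (hq k))
  have hrep : ∀ k, ∃ a ∈ A, a.toFun = (q (k + 1) - q k).toFun := fun k =>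
    belongsTo_of_mem_regSpan (Submodule.sub_mem _ (hq (k + 1)).1 (hq k).1)
  choose u huA hu using hrep
  refine hc (containsC0_regSpanNorm hA huA (fun k => ?_) (P := P.toFun) (fun S => ?_) hε
    fun k => ?_)
  · rw [hu]
    exact RegPoly.nonneg_iff.mp (hmono k)
  · obtain ⟨N, hN⟩ := S.exists_nat_subset_range
    have h1 : ∑ k ∈ S, (q (k + 1) - q k) ≤ P :=
      calc ∑ k ∈ S, (q (k + 1) - q k) ≤ ∑ k ∈ Finset.range N, (q (k + 1) - q k) :=
            Finset.sum_le_sum_of_subset_of_nonneg hN fun k _ _ => hmono k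
        _ = q N - q 0 := Finset.sum_range_sub q N
        _ ≤ q N := sub_le_self _ (hq 0).2.1
        _ ≤ P := (hq N).2.2
    rw [RegPoly.le_def, RegPoly.toFun_sum] at h1
    simpa only [hu] using h1
  · rw [ContPoly.norm_def, hu, hqs]
    exact hfε _ (hq k)

/-- Beyond `q k` all minorants lie within `1 / (k + 1)` of it, so the `q k` converge. Any given
minorant `Q` sits below minorants equally close to the `q k`, and passing to the limit puts `Q`
below the limit of the `q k`. -/
theorem exists_isGreatest_positiveMinorants (hF : IsDedekindComplete F)
    (hA : IsClosed (A : Set (ContPoly n E F))) (hdom : HasDominationProperty A)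
    (hc : ¬ ContainsC0 (regSpanNorm A)) {P : RegPoly n E F} (hP : 0 ≤ P) :
    ∃ R, IsGreatest (positiveMinorants A P) R := by
  choose q hq hqlt using fun k : ℕ =>
    exists_positiveMinorant_norm_sub_lt hA hc hP (Nat.one_div_pos_of_nat (α := ℝ) (n := k))
  choose a haA ha using fun k => belongsTo_of_mem_regSpan (hq k).1
  have hnear : ∀ k, ∀ Q ∈ positiveMinorants A P, ∃ b ∈ A, IsPosPoly n (b.toFun - Q.toFun) ∧
      IsPosPoly n (P.toFun - b.toFun) ∧ ‖b - a k‖ < 1 / ((k : ℝ) + 1) := by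
    intro k Q hQ
    obtain ⟨U, hU, h1, h2⟩ := exists_ge_positiveMinorants hF hdom (hq k) hQ
    obtain ⟨b, hbA, hb⟩ := belongsTo_of_mem_regSpan hU.1
    refine ⟨b, hbA, hb ▸ h2, hb ▸ hU.2.2, ?_⟩
    rw [ContPoly.norm_def, ContPoly.toFun_sub, hb, ha]
    exact hqlt k U hU h1
  have hcauchy : CauchySeq a := by
    rw [Metric.cauchySeq_iff']
    intro ε hε
    obtain ⟨N, hN⟩ := exists_nat_one_div_lt (half_pos hε)
    refine ⟨N, fun k hk => ?_⟩
    obtain ⟨U, hU, h1, h2⟩ := exists_ge_positiveMinorants hF hdom (hq k) (hq N)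
    obtain ⟨b, -, hb⟩ := belongsTo_of_mem_regSpan hU.1
    have h3 : ‖b - a k‖ < 1 / ((k : ℝ) + 1) := by
      rw [ContPoly.norm_def, ContPoly.toFun_sub, hb, ha]
      exact hqlt k U hU h1
    have h4 : ‖b - a N‖ < 1 / ((N : ℝ) + 1) := by
      rw [ContPoly.norm_def, ContPoly.toFun_sub, hb, ha]
      exact hqlt N U hU h2
    have h5 : 1 / ((k : ℝ) + 1) ≤ 1 / ((N : ℝ) + 1) := Nat.one_div_le_one_div hk
    rw [dist_eq_norm]
    have h6 : ‖a k - a N‖ ≤ ‖b - a N‖ + ‖b - a k‖ := by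
      rw [show a k - a N = (b - a N) - (b - a k) by abel]
      exact norm_sub_le _ _
    linarith
  obtain ⟨r, hr⟩ := cauchySeq_tendsto_of_complete hcauchy
  have hrA : r ∈ A := hA.mem_of_tendsto hr (Filter.Eventually.of_forall haA)
  have hlim : ∀ b : ℕ → ContPoly n E F, (∀ k, ‖b k - a k‖ < 1 / ((k : ℝ) + 1)) →
      Filter.Tendsto b Filter.atTop (nhds r) := by
    intro b hb
    have h1 : Filter.Tendsto (fun k => b k - a k) Filter.atTop (nhds 0) :=
      squeeze_zero_norm (fun k => (hb k).le) tendsto_one_div_add_atTop_nhds_zero_nat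
    have h2 := h1.add hr
    simpa using h2
  have hupper : ∀ Q ∈ positiveMinorants A P, IsPosPoly n (r.toFun - Q.toFun) := by
    intro Q hQ
    choose b hbA hbQ hbP hb using fun k => hnear k Q hQ
    exact IsPosPoly.of_tendsto hbQ fun x =>
      (ContPoly.tendsto_apply (hlim b hb) x).sub_const (Q.toFun x)
  have hle : IsPosPoly n (P.toFun - r.toFun) := by
    choose b hbA hbQ hbP hb using fun k => hnear k 0 (zero_mem_positiveMinorants hP)
    exact IsPosPoly.of_tendsto hbP fun x =>
      (ContPoly.tendsto_apply (hlim b hb) x).const_sub (P.toFun x)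
  have hr0 : IsPosPoly n r.toFun := by
    simpa using hupper 0 (zero_mem_positiveMinorants hP)
  exact ⟨RegPoly.ofPos _ hr0, ⟨mem_regSpan_of_nonneg (RegPoly.ofPos_nonneg _ _) ⟨r, hrA, rfl⟩,
    RegPoly.ofPos_nonneg _ _, hle⟩, fun Q hQ => hupper Q hQ⟩

theorem isProjectionBand_regSpan (hF : IsDedekindComplete F)
    (hA : IsClosed (A : Set (ContPoly n E F))) (hdom : HasDominationProperty A)
    (hc : ¬ ContainsC0 (regSpanNorm A)) : IsProjectionBand (regSpan A) := by
  let _ : Lattice (RegPoly n E F) := RegPoly.lattice hF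
  exact isProjectionBand_of_exists_isGreatest (isOrderIdeal_regSpan hdom) fun P hP =>
    exists_isGreatest_positiveMinorants hF hA hdom hc hP

end GreatestMinorant

/-! ### Atoms and their coordinate functionals -/

section Atoms

variable {F : Type*} [NormedAddCommGroup F] [NormedSpace ℝ F] [Lattice F]
  [IsOrderedAddMonoid F] [IsOrderedModule ℝ F] [HasSolidNorm F]

theorem smul_le_smul_iff_of_pos_vector {a : F} (ha : 0 < a) {c d : ℝ} :
    c • a ≤ d • a ↔ c ≤ d := by
  constructor
  · intro h
    by_contra! hcd
    have h1 : (c - d) • a ≤ 0 := by rw [sub_smul]; exact sub_nonpos.mpr h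
    have h2 := smul_le_smul_of_nonneg_left h1 (inv_nonneg.mpr (sub_pos.mpr hcd).le)
    rw [inv_smul_smul₀ (sub_pos.mpr hcd).ne', smul_zero] at h2
    exact absurd ha h2.not_gt
  · intro h
    exact smul_le_smul_of_nonneg_right h ha.le

theorem IsRieszAtom.bddAbove {a : F} (ha : IsRieszAtom a) (x : F) :
    BddAbove {c : ℝ | c • a ≤ x} := by
  refine ⟨‖x‖ / ‖a‖, fun c hc => ?_⟩
  rcases le_or_gt c 0 with h0 | h0
  · exact h0.trans (by positivity)
  · rw [le_div_iff₀ (norm_pos_iff.mpr ha.1.ne')]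
    have h1 : |c • a| ≤ |x| := by
      rw [abs_of_nonneg (smul_nonneg h0.le ha.1.le)]
      exact le_trans hc (le_abs_self x)
    have := norm_le_norm_of_abs_le_abs h1
    rwa [norm_smul, Real.norm_of_nonneg h0.le] at this

/-- The supremum is attained, because the order is closed in the norm topology. -/
theorem IsRieszAtom.sSup_smul_le {a : F} (ha : IsRieszAtom a) {x : F} (hx : 0 ≤ x) :
    sSup {c : ℝ | c • a ≤ x} • a ≤ x := by
  have hcl : IsClosed {c : ℝ | c • a ≤ x} :=
    isClosed_le (continuous_id.smul continuous_const) continuous_const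
  exact hcl.csSup_mem ⟨0, by simpa using hx⟩ (ha.bddAbove x)

theorem IsRieszAtom.exists_smul_of_le_smul {a : F} (ha : IsRieszAtom a) {c : ℝ} (hc : 0 ≤ c)
    {y : F} (hy : 0 ≤ y) (hyc : y ≤ c • a) : ∃ d : ℝ, y = d • a := by
  rcases hc.eq_or_lt with rfl | hc
  · rw [zero_smul] at hyc
    exact ⟨0, by rw [zero_smul]; exact hyc.antisymm hy⟩
  · have h1 := smul_le_smul_of_nonneg_left hyc (inv_nonneg.mpr hc.le)
    rw [inv_smul_smul₀ hc.ne'] at h1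
    obtain ⟨d, hd⟩ := ha.2 _ (smul_nonneg (inv_nonneg.mpr hc.le) hy) h1
    exact ⟨c * d, by rw [mul_smul, ← hd, smul_inv_smul₀ hc.ne']⟩

/-- The coordinate functional of an atom. -/
theorem IsRieszAtom.exists_coord {a : F} (ha : IsRieszAtom a) :
    ∃ L : F →ₗ[ℝ] ℝ, ∀ x, 0 ≤ x → L x • a ≤ x ∧ ∀ c : ℝ, c • a ≤ x → c ≤ L x := by
  have hnn : ∀ x : F, 0 ≤ x → 0 ≤ sSup {c : ℝ | c • a ≤ x} := fun x hx =>
    le_csSup (ha.bddAbove x) (by simpa using hx)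
  obtain ⟨L, hL⟩ := exists_linearMap_extending_cone (E := F) (G := ℝ)
    (fun x => sSup {c : ℝ | c • a ≤ x}) (fun x y hx hy => by
      refine le_antisymm ?_ ?_
      · set c := sSup {c : ℝ | c • a ≤ x + y} with hc
        have hc0 : 0 ≤ c := hnn _ (add_nonneg hx hy)
        have hca : c • a ≤ x + y := ha.sSup_smul_le (add_nonneg hx hy)
        -- Riesz decomposition of `c • a + (x + y - c • a) = x + y` splits `c • a` into a part below
        -- `x` and a part below `y`; since `a` is an atom, both are multiples of `a`.
        obtain ⟨x₁, x₂, y₁, y₂, hx₁, hx₂, hy₁, hy₂, rfl, rfl, h₁, -⟩ :=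
          riesz_decomposition (smul_nonneg hc0 ha.1.le) (sub_nonneg.mpr hca) hx hy (by abel)
        obtain ⟨d, hd⟩ := ha.exists_smul_of_le_smul hc0 hx₁
          (h₁ ▸ le_add_of_nonneg_right hy₁)
        obtain ⟨e, he⟩ := ha.exists_smul_of_le_smul hc0 hy₁
          (h₁ ▸ le_add_of_nonneg_left hx₁)
        have h2 : c ≤ d + e := by
          rw [← smul_le_smul_iff_of_pos_vector ha.1, add_smul, ← hd, ← he]
          exact h₁.le
        refine h2.trans (add_le_add (le_csSup (ha.bddAbove _) ?_) (le_csSup (ha.bddAbove _) ?_))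
        · change d • a ≤ _
          rw [← hd]; exact le_add_of_nonneg_right hx₂
        · change e • a ≤ _
          rw [← he]; exact le_add_of_nonneg_right hy₂
      · refine le_csSup (ha.bddAbove _) ?_
        change _ • a ≤ _
        rw [add_smul]
        exact add_le_add (ha.sSup_smul_le hx) (ha.sSup_smul_le hy)) (fun c x hc hx => by
      have h1 : ∀ (c : ℝ) (x : F), 0 < c → 0 ≤ x →
          c * sSup {c : ℝ | c • a ≤ x} ≤ sSup {d : ℝ | d • a ≤ c • x} := by
        intro c x hc hx
        refine le_csSup (ha.bddAbove _) ?_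
        change _ • a ≤ _
        rw [mul_smul]
        exact smul_le_smul_of_nonneg_left (ha.sSup_smul_le hx) hc.le
      refine le_antisymm ?_ (h1 c x hc hx)
      have h2 := h1 c⁻¹ (c • x) (inv_pos.mpr hc) (smul_nonneg hc.le hx)
      rw [inv_smul_smul₀ hc.ne', inv_mul_le_iff₀ hc] at h2
      exact h2)
  refine ⟨L, fun x hx => ?_⟩
  rw [hL x hx]
  exact ⟨ha.sSup_smul_le hx, fun c hc => le_csSup (ha.bddAbove x) hc⟩

/-- In an atomic vector lattice, a positive element is the supremum of the multiples of atoms that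
it dominates. -/
theorem IsAtomicRiesz.le_of_forall_atom (hat : IsAtomicRiesz F) {w u : F}
    (h : ∀ a, IsRieszAtom a → ∃ c : ℝ, (∀ d : ℝ, d • a ≤ w → d ≤ c) ∧ c • a ≤ w ∧ c • a ≤ u) :
    w ≤ u := by
  by_contra hwu
  -- An atom `a` below this difference could be added to `c • a ≤ w ⊓ u`, giving `(c + 1) • a ≤ w`
  -- against the maximality of `c`.
  have h1 : 0 < w - w ⊓ u := by
    refine lt_of_le_of_ne (sub_nonneg.mpr inf_le_left) fun h0 => hwu ?_
    rw [← inf_eq_left]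
    exact (sub_eq_zero.mp h0.symm).symm
  obtain ⟨a, ha, hle⟩ := hat _ h1
  obtain ⟨c, hmax, hcw, hcu⟩ := h a ha
  have h2 : (c + 1) • a ≤ w := by
    rw [add_smul, one_smul]
    calc c • a + a ≤ w ⊓ u + (w - w ⊓ u) := add_le_add (le_inf hcw hcu) hle
      _ = w := by abel
  have := hmax _ h2
  linarith

end Atoms

/-! ### Bands containing the finite rank polynomials -/

section AtomicRange

variable {n : ℕ} {E F : Type*} [NormedAddCommGroup E] [NormedSpace ℝ E] [Lattice E]
  [IsOrderedAddMonoid E] [NormedAddCommGroup F] [NormedSpace ℝ F] [Lattice F]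
  [IsOrderedAddMonoid F] [IsOrderedModule ℝ F] [HasSolidNorm F]
  {A : Submodule ℝ (ContPoly n E F)}

theorem belongsTo_of_isBand_regSpan (hat : IsAtomicRiesz F)
    (hfin : ∀ P : E → F, IsPosPoly n P →
      FiniteDimensional ℝ (Submodule.span ℝ (Set.range P)) → BelongsTo A P)
    (hband : IsBand (regSpan A)) {P : E → F} (hP : IsPosPoly n P) : BelongsTo A P := by
  set Q := RegPoly.ofPos P hP with hQ
  have hQ0 : 0 ≤ Q.toMultilinear := RegPoly.nonneg_iff'.mp (RegPoly.ofPos_nonneg P hP)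
  have hlub : IsLUB {R : RegPoly n E F | R ∈ regSpan A ∧ R ≤ Q} Q := by
    refine ⟨fun R hR => hR.2, fun U hU => RegPoly.le_iff.mpr fun v hv => ?_⟩
    refine hat.le_of_forall_atom fun a ha => ?_
    obtain ⟨L, hL⟩ := ha.exists_coord
    -- The projection of `F` onto the line of `a`. Composing it with `P` gives a minorant of rank at
    -- most one, hence in `A`, so every upper bound `U` dominates the `a`-component of `P`.
    let M : F →ₗ[ℝ] F := L.smulRight a
    have hM0 : ∀ x, 0 ≤ x → 0 ≤ M x := fun x hx =>
      smul_nonneg ((hL x hx).2 0 (by simpa using hx)) ha.1.le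
    have hassoc : IsAssociated (M.compMultilinearMap Q.toMultilinear) fun x => M (P x) := by
      refine ⟨fun σ w => ?_, fun x => ?_⟩
      · change M (Q.toMultilinear _) = M (Q.toMultilinear _)
        rw [Q.isAssociated.1]
      · change M (P x) = M (Q.toMultilinear _)
        rw [← Q.isAssociated.2]
        rfl
    have hpos : IsPosPoly n fun x => M (P x) := ⟨_, hassoc, fun w hw => hM0 (Q.toMultilinear w) (hQ0 w hw)⟩
    have hfd : FiniteDimensional ℝ (Submodule.span ℝ (Set.range fun x => M (P x))) := by
      refine Submodule.finiteDimensional_of_le (S₂ := Submodule.span ℝ {a}) ?_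
      rw [Submodule.span_le]
      rintro _ ⟨x, rfl⟩
      exact Submodule.smul_mem _ _ (Submodule.mem_span_singleton_self a)
    set R := RegPoly.ofPos _ hpos with hR
    have hRM : R.toMultilinear = M.compMultilinearMap Q.toMultilinear :=
      R.isAssociated.unique hassoc
    have hRQ : R ≤ Q := RegPoly.le_iff.mpr fun w hw => by
      rw [hRM]
      exact (hL _ (hQ0 w hw)).1
    have hRU : R ≤ U := hU ⟨mem_regSpan_of_nonneg (RegPoly.ofPos_nonneg _ _) (hfin _ hpos hfd), hRQ⟩
    have hRUv := RegPoly.le_iff.mp hRU v hv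
    rw [hRM] at hRUv
    exact ⟨L (Q.toMultilinear v), (hL _ (hQ0 v hv)).2, (hL _ (hQ0 v hv)).1, hRUv⟩
  exact belongsTo_of_mem_regSpan (hband.2 _ Q (fun R hR => hR.1) hlub)

end AtomicRange

/-! ### The main theorem -/

theorem theorem4p2 (n : ℕ)
    (E : Type*) [NormedAddCommGroup E] [NormedSpace ℝ E] [Lattice E] [IsOrderedAddMonoid E]
    [IsOrderedModule ℝ E] [HasSolidNorm E] [CompleteSpace E]
    (F : Type*) [NormedAddCommGroup F] [NormedSpace ℝ F] [Lattice F] [IsOrderedAddMonoid F]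
    [IsOrderedModule ℝ F] [HasSolidNorm F] [CompleteSpace F]
    (hF : IsDedekindComplete F)
    (A : Submodule ℝ (ContPoly n E F)) (hA : IsClosed (A : Set (ContPoly n E F)))
    (hdom : HasDominationProperty A) :
    (¬ ContainsC0 (regNorm : RegPoly n E F → ℝ) → ¬ ContainsC0 (regSpanNorm A)) ∧
    (¬ ContainsC0 (regSpanNorm A) → IsProjectionBand (regSpan A)) ∧
    (IsAtomicRiesz F → HasOrderContinuousNorm F →
      (∀ P : E → F, IsPosPoly n P →
        FiniteDimensional ℝ (Submodule.span ℝ (Set.range P)) → BelongsTo A P) →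
      IsProjectionBand (regSpan A) → ∀ P : E → F, IsPosPoly n P → BelongsTo A P) := by
  exact ⟨fun h h' => h (h'.regNorm_of_regSpanNorm hF hdom),
    fun h => isProjectionBand_regSpan hF hA hdom h,
    fun hat _ hfin hband P hP => belongsTo_of_isBand_regSpan hat hfin hband.1 hP⟩
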